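/- Let $\mathbb{V}$ be a finite set of variables $x_i\in\{1,\dots,q\}$ and $\mathbb{F}$ a finite set of factors, each factor $a$ being attached to a subset of $\mathbb{V}$ (also written $a$). Let $\phi_i(x_i)>0$ and $\psi_a(\mathbf{x}_a)>0$ be given, where $\mathbf{x}_a=(x_i)_{i\in a}$, and consider the Markov random field $p(\mathbf{x})\propto\prod_i\phi_i(x_i)\prod_a\psi_a(\mathbf{x}_a)$. Let $\mathbb{E}$ be the set of edges $(a,i)$, $i\in a$, of the factor graph. For messages $m=(m_{a\to i}(k))_{(a,i)\in\mathbb{E},\,1\le k\le q}$ put $$n_{j\to a}(k)=\phi_j(k)\prod_{a'\ni j,\,a'\neq a}m_{a'\to j}(k),\qquad \Theta_{ai,k}(m)=\sum_{\mathbf{x}_a:\,x_i=k}\psi_a(\mathbf{x}_a)\prod_{j\in a\setminus i}n_{j\to a}(x_j),$$ and let the sum-normalized belief propagation (BP) scheme be the iteration of the map $$m_{a\to i}(k)\leftarrow\frac{\Theta_{ai,k}(m)}{\sum_{x=1}^q\Theta_{ai,x}(m)}.$$ Let $m$ be a fixed point of this map with strictly positive entries, and let $b_i(k)\propto\phi_i(k)\prod_{a\ni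 i}m_{a\to i}(k)$ and $b_a(\mathbf{x}_a)\propto\psi_a(\mathbf{x}_a)\prod_{i\in a}n_{i\to a}(x_i)$ be the associated beliefs, normalized to have sum $1$. For variables $i\neq j$ of a factor $a$ let $B^{(iaj)}$ be the $q\times q$ stochastic matrix of conditional beliefs $$b^{(iaj)}_{k\ell}=b_a(x_j=\ell\mid x_i=k)=\sum_{\mathbf{x}_a:\,x_i=k,\,x_j=\ell}\frac{b_a(\mathbf{x}_a)}{b_i(k)},$$ let $K^{(iaj)}=B^{(iaj)}B^{(jai)}$ (a reversible kernel, hence with real eigenvalues), let $\mu_2^{(iaj)}$ be the second largest eigenvalue of $K^{(iaj)}$, counted with multiplicity ($0$ if $q\le 1$), and let $\mu_2=\max_{(iaj)}\sqrt{|\mu_2^{(iaj)}|}$ ($0$ if there is no such triple). Let $A$ be the adjacency matrix of the oriented line graph of the factor graph: it is indexed by $\mathbb{E}$, with $A_{ai}^{a'j}=1$ if $j\in a\cap a'$, $j\neq i$ and $a'\neq a$, and $A_{ai}^{a'j}=0$ otherwise. Let $\lambda_1$ be its Perron eigenvalue, i.e. its spectral radius. (i) If $\lambda_1\mu_2<1$,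 then $m$ is a locally stable fixed point of the sum-normalized BP scheme: it is Lyapunov stable (orbits that start close to $m$ stay close to $m$) and locally attractive (orbits that start close to $m$ converge to $m$). (ii) In the homogeneous case (all the matrices $B^{(iaj)}$ are equal), $\lambda_1\mu_2\le 1$ is also necessary for stability: if $m$ is Lyapunov stable, then $\lambda_1\mu_2\le 1$. -/

import Mathlib

open Filter Topology

noncomputable section

/-- A strictly positive Markov random field with variables `V`, each with values in a set of `q`
elements, and factors `F`: the factor `a` is attached to the set of variables `scope a`, `φ i` is
the local potential of the variable `i` and `ψ a` the potential of the factor `a`, a function of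
`x_a = (x_i)_{i ∈ a}`. -/
structure MarkovField (V F : Type*) (q : ℕ) where
  scope : F → Finset V
  φ : V → Fin q → ℝ
  ψ : (a : F) → ({i // i ∈ scope a} → Fin q) → ℝ
  φ_pos : ∀ i k, 0 < φ i k
  ψ_pos : ∀ a x, 0 < ψ a x

/-- `x` is a Lyapunov stable fixed point of `f`: orbits that start close to `x` stay close to
`x`. -/
def LyapunovStable {X : Type*} [TopologicalSpace X] (f : X → X) (x : X) : Prop :=
  f x = x ∧ ∀ U ∈ 𝓝 x, ∀ᶠ y in 𝓝 x, ∀ n : ℕ, f^[n] y ∈ U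

/-- `x` is locally attractive for `f`: orbits that start close to `x` converge to `x`. -/
def LocallyAttractive {X : Type*} [TopologicalSpace X] (f : X → X) (x : X) : Prop :=
  ∀ᶠ y in 𝓝 x, Tendsto (fun n : ℕ => f^[n] y) atTop (𝓝 x)

/-- The second largest eigenvalue, counted with multiplicity, of a square matrix with real
eigenvalues: second entry of the list, in decreasing order, of the roots of the characteristic
polynomial (`0` by convention if there is no second eigenvalue). -/
def secondEigenvalue {q : ℕ} (K : Matrix (Fin q) (Fin q) ℝ) : ℝ :=
  (K.charpoly.roots.sort (· ≥ ·)).getD 1 0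

/-- The Perron eigenvalue of a square matrix with nonnegative entries, that is, its spectral
radius: the largest modulus of a complex eigenvalue. -/
def perronEigenvalue {E : Type*} [Fintype E] [DecidableEq E] (A : Matrix E E ℝ) : ℝ :=
  (spectralRadius ℂ (A.map (fun r : ℝ => (r : ℂ)))).toReal

namespace MarkovField

variable {V F : Type*} {q : ℕ}

/-- The edges of the factor graph: the pairs `(a, i)` with `i ∈ a`. -/
abbrev Edge (M : MarkovField V F q) : Type _ := {e : F × V // e.2 ∈ M.scope e.1}

/-- A family of messages `m_{a → i}(k)`, indexed by the edges `(a, i)` and the values `k`. -/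
abbrev Messages (M : MarkovField V F q) : Type _ := M.Edge → Fin q → ℝ

variable [Fintype V] [DecidableEq V] [Fintype F] [DecidableEq F]

/-- The message `n_{j → a}(k) = φ_j(k) ∏_{a' ∋ j, a' ≠ a} m_{a' → j}(k)`. -/
def varMessage (M : MarkovField V F q) (m : M.Messages) (j : V) (a : F) (k : Fin q) : ℝ :=
  M.φ j k * ∏ e : M.Edge with e.1.2 = j ∧ e.1.1 ≠ a, m e k

/-- The unnormalized update
`Θ_{ai,k}(m) = ∑_{x_a : x_i = k} ψ_a(x_a) ∏_{j ∈ a, j ≠ i} n_{j → a}(x_j)`. -/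
def theta (M : MarkovField V F q) (m : M.Messages) : M.Messages := fun e k =>
  ∑ x : ({j // j ∈ M.scope e.1.1} → Fin q) with x ⟨e.1.2, e.2⟩ = k,
    M.ψ e.1.1 x *
      ∏ j : {j // j ∈ M.scope e.1.1} with j.1 ≠ e.1.2, M.varMessage m j.1 e.1.1 (x j)

/-- One step of the belief propagation scheme in which the messages are normalized by their
sum: `m_{a → i}(k) ← Θ_{ai,k}(m) / ∑_x Θ_{ai,x}(m)`. -/
def bpStep (M : MarkovField V F q) (m : M.Messages) : M.Messages := fun e k =>
  M.theta m e k / ∑ x : Fin q, M.theta m e x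

/-- The unnormalized variable belief `φ_i(k) ∏_{a ∋ i} m_{a → i}(k)`. -/
def varWeight (M : MarkovField V F q) (m : M.Messages) (i : V) (k : Fin q) : ℝ :=
  M.φ i k * ∏ e : M.Edge with e.1.2 = i, m e k

/-- The belief `b_i(k)` of the variable `i`. -/
def varBelief (M : MarkovField V F q) (m : M.Messages) (i : V) (k : Fin q) : ℝ :=
  M.varWeight m i k / ∑ x : Fin q, M.varWeight m i x

/-- The unnormalized factor belief `ψ_a(x_a) ∏_{i ∈ a} n_{i → a}(x_i)`. -/
def factorWeight (M : MarkovField V F q) (m : M.Messages) (a : F)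
    (x : {i // i ∈ M.scope a} → Fin q) : ℝ :=
  M.ψ a x * ∏ i : {i // i ∈ M.scope a}, M.varMessage m i.1 a (x i)

/-- The belief `b_a(x_a)` of the factor `a`. -/
def factorBelief (M : MarkovField V F q) (m : M.Messages) (a : F)
    (x : {i // i ∈ M.scope a} → Fin q) : ℝ :=
  M.factorWeight m a x / ∑ y : ({i // i ∈ M.scope a} → Fin q), M.factorWeight m a y

/-- The matrix `B^{(iaj)}` of conditional beliefs,
`b_{kl}^{(iaj)} = b_a(x_j = l | x_i = k) = ∑_{x_a : x_i = k, x_j = l} b_a(x_a) / b_i(x_i)`. -/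
def condBelief (M : MarkovField V F q) (m : M.Messages) (a : F)
    (i j : {i // i ∈ M.scope a}) : Matrix (Fin q) (Fin q) ℝ := fun k l =>
  ∑ x : ({i // i ∈ M.scope a} → Fin q) with x i = k ∧ x j = l,
    M.factorBelief m a x / M.varBelief m i.1 (x i)

/-- The combined kernel `K^{(iaj)} = B^{(iaj)} B^{(jai)}`. -/
def combinedKernel (M : MarkovField V F q) (m : M.Messages) (a : F)
    (i j : {i // i ∈ M.scope a}) : Matrix (Fin q) (Fin q) ℝ :=
  M.condBelief m a i j * M.condBelief m a j i

/-- The triples `(i, a, j)`, where `i ≠ j` are two variables of the factor `a`. -/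
abbrev Triple (M : MarkovField V F q) : Type _ :=
  (a : F) × {p : {i // i ∈ M.scope a} × {i // i ∈ M.scope a} // p.1 ≠ p.2}

/-- `μ₂`: the maximum over all triples `(i, a, j)` of the square root of the absolute value of
the second largest eigenvalue of `K^{(iaj)}` (`0` if there is no such triple). -/
def mu2 (M : MarkovField V F q) (m : M.Messages) : ℝ :=
  ⨆ t : M.Triple, Real.sqrt |secondEigenvalue (M.combinedKernel m t.1 t.2.1.1 t.2.1.2)|

/-- The adjacency matrix of the oriented line graph of the factor graph: the vertices are the
edges of the factor graph, and `(a, i)` is linked to `(a', j)` if `j ∈ a ∩ a'`, `j ≠ i` and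
`a' ≠ a`. -/
def lineAdj (M : MarkovField V F q) : Matrix M.Edge M.Edge ℝ := fun e e' =>
  if e'.1.2 ∈ M.scope e.1.1 ∩ M.scope e'.1.1 ∧ e'.1.2 ≠ e.1.2 ∧ e'.1.1 ≠ e.1.1 then 1 else 0

/-- `λ₁`: the Perron eigenvalue of the adjacency matrix of the oriented line graph. -/
def lambda1 (M : MarkovField V F q) : ℝ := perronEigenvalue M.lineAdj

/-- The system is homogeneous at `m`: all the matrices `B^{(iaj)}` are equal. -/
def Homogeneous (M : MarkovField V F q) (m : M.Messages) : Prop :=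
  ∃ B : Matrix (Fin q) (Fin q) ℝ,
    ∀ (a : F) (i j : {i // i ∈ M.scope a}), i ≠ j → M.condBelief m a i j = B

end MarkovField

end

/-!
# Local stability of sum-normalized belief propagation

At a positive fixed point `m`, write a perturbation of `m` in the logarithmic coordinates
`u = v / m`. The chain rule gives `∂ log Θ_{ai,k} / ∂ log m_{a'j}(ℓ) = A_{ai}^{a'j} b^{(iaj)}_{kℓ}`,
so the unnormalized update is linearized by the operator `T` (`MarkovField.transfer`) that combines
the line-graph adjacency matrix `A` with the stochastic matrices `B^{(iaj)}`. Normalization composes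
`T` with a linear map `R` (`MarkovField.ofLog`) whose kernel consists of the perturbations that are
constant on every edge. As `T` preserves these, the Jacobian `J` satisfies
`J ^ n = R ∘ T ^ n ∘ L` for `n ≥ 1`, where `L` is the passage to logarithmic coordinates
(`MarkovField.jacobian_pow_succ`).

*Sufficiency.* The fixed-point equation makes `b_a` and `b_i` consistent, so `B^{(iaj)}` and
`B^{(jai)}` are adjoint between `L²(b_j)` and `L²(b_i)`. Hence `K^{(iaj)}` is symmetric, and its
second eigenvalue bounds the quadratic form of `K^{(iaj)}` on the functions of mean zero. So each
`B^{(iaj)}` contracts mean-zero functions by the factor `μ₂`, and the vector of the `L²(b_i)` norms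
of a centered `u` is multiplied by at most `μ₂ A` (`MarkovField.edgeNorm_transfer_pow_le`). With
Gelfand's formula for `A` this gives `‖J ^ n‖ ≤ C (ρ μ₂) ^ n` for every `ρ > λ₁`. When
`λ₁ μ₂ < 1`, some power of `J` has norm less than one, and an iterate of the scheme is a contraction
near `m`.

*Necessity.* If all `B^{(iaj)}` equal `B`, then `K = B²` and `B` has a nonconstant eigenvector `v`
with eigenvalue `ν = ± μ₂`. The space of the perturbations `u_e(k) = w_e v(k)` is mapped by `T` to
itself, as `w ↦ ν A w`. Taking for `w` the real part of a rotated complex eigenvector of `A` for an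
eigenvalue of modulus `λ₁` gives perturbations whose `n`-th image under `J` has size of the exact
order `(λ₁ μ₂) ^ n`. If `r = λ₁ μ₂ > 1`, then `‖J ^ n‖ ≤ C s ^ n` with `s < r ^ 2`. The nonlinear
corrections along an orbit of initial size `η / r ^ n` are then of order `η ^ 2` at time `n`, while
the linear part is of order `η`, so the orbit leaves a fixed neighbourhood of `m`
(`not_lyapunovStable_of_growth`). No Perron–Frobenius theorem is needed.
-/

open scoped Matrix

set_option linter.unusedSectionVars false

noncomputable section

/-! ### Stability and instability of fixed points of differentiable maps -/

/-- If `‖J ^ N‖ < 1`, then `f^[N]` contracts distances to `x` near `x`, and the remaining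
`f^[r]` with `r < N` are controlled by continuity. -/
theorem stable_of_norm_pow_lt_one {E : Type*} [NormedAddCommGroup E] [NormedSpace ℝ E]
    {f : E → E} {x : E} {J : E →L[ℝ] E} (hf : HasFDerivAt f J x) (hx : f x = x)
    {N : ℕ} (hN : 0 < N) (hJ : ‖J ^ N‖ < 1) :
    LyapunovStable f x ∧ LocallyAttractive f x := by
  obtain ⟨c, hc, hc1⟩ := exists_between hJ
  have hc0 : 0 ≤ c := (norm_nonneg _).trans hc.le
  have hfN : HasFDerivAt f^[N] (J ^ N) x := hf.iterate hx N
  have hfix : ∀ n, f^[n] x = x := fun n => Function.iterate_fixed hx n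
  have hcont : ∀ n, ContinuousAt f^[n] x := fun n => (hf.iterate hx n).continuousAt
  have hcontr : ∀ᶠ y in 𝓝 x, ‖f^[N] y - x‖ ≤ c * ‖y - x‖ := by
    have h := hfN.isLittleO.def (sub_pos.2 hc)
    filter_upwards [h] with y hy
    rw [hfix] at hy
    calc ‖f^[N] y - x‖ = ‖(f^[N] y - x - (J ^ N) (y - x)) + (J ^ N) (y - x)‖ := by
          rw [sub_add_cancel]
      _ ≤ (c - ‖J ^ N‖) * ‖y - x‖ + ‖J ^ N‖ * ‖y - x‖ :=
          (norm_add_le _ _).trans (add_le_add hy ((J ^ N).le_opNorm _))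
      _ = c * ‖y - x‖ := by ring
  obtain ⟨δ, hδ, hball⟩ := Metric.eventually_nhds_iff.1 hcontr
  have hiter : ∀ y, ‖y - x‖ < δ → ∀ k, ‖f^[N * k] y - x‖ ≤ c ^ k * ‖y - x‖ := by
    intro y hy k
    induction k with
    | zero => simp
    | succ k ih =>
      have hk : ‖f^[N * k] y - x‖ < δ := by
        refine (ih.trans ?_).trans_lt hy
        exact mul_le_of_le_one_left (norm_nonneg _) (pow_le_one₀ hc0 hc1.le)
      have h1 := hball (y := f^[N * k] y) (by rwa [dist_eq_norm])
      rw [← Function.iterate_add_apply] at h1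
      rw [show N * (k + 1) = N + N * k by ring]
      refine h1.trans ?_
      rw [pow_succ']
      calc c * ‖f^[N * k] y - x‖ ≤ c * (c ^ k * ‖y - x‖) := by gcongr
        _ = _ := by ring
  have hV : ∀ U ∈ 𝓝 x, ∀ᶠ y in 𝓝 x, ∀ r ∈ Finset.range N, f^[r] y ∈ U := by
    intro U hU
    rw [Filter.eventually_all_finset]
    intro r _
    refine (hcont r).eventually ?_
    rw [hfix]
    exact hU
  have hsplit : ∀ n y, f^[n] y = f^[n % N] (f^[N * (n / N)] y) := by
    intro n y
    rw [← Function.iterate_add_apply, Nat.mod_add_div]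
  constructor
  · refine ⟨hx, fun U hU => ?_⟩
    obtain ⟨ε, hε, hεV⟩ := Metric.eventually_nhds_iff.1 (hV U hU)
    refine Metric.eventually_nhds_iff.2 ⟨min δ ε, lt_min hδ hε, fun y hy n => ?_⟩
    rw [dist_eq_norm] at hy
    rw [hsplit]
    refine hεV ?_ _ (Finset.mem_range.2 (Nat.mod_lt _ hN))
    rw [dist_eq_norm]
    refine (hiter y (hy.trans_le (min_le_left _ _)) _).trans_lt ?_
    refine (mul_le_of_le_one_left (norm_nonneg _) (pow_le_one₀ hc0 hc1.le)).trans_lt ?_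
    exact hy.trans_le (min_le_right _ _)
  · refine Metric.eventually_nhds_iff.2 ⟨δ, hδ, fun y hy => ?_⟩
    rw [dist_eq_norm] at hy
    have hlim : Tendsto (fun k => f^[N * k] y) atTop (𝓝 x) := by
      rw [tendsto_iff_norm_sub_tendsto_zero]
      refine squeeze_zero (fun _ => norm_nonneg _) (hiter y hy) ?_
      simpa using (tendsto_pow_atTop_nhds_zero_of_lt_one hc0 hc1).mul_const ‖y - x‖
    intro U hU
    have h1 := (hlim.comp (Nat.tendsto_div_const_atTop hN.ne')).eventually (hV U hU)
    rw [Filter.mem_map]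
    filter_upwards [h1] with n hn
    have := hn (n % N) (Finset.mem_range.2 (Nat.mod_lt _ hN))
    rw [Set.mem_preimage, hsplit]
    exact this

/-- Taylor's formula of order two at a point of analyticity. -/
theorem AnalyticAt.exists_quadratic_remainder {E : Type*} [NormedAddCommGroup E] [NormedSpace ℝ E]
    {f : E → E} {x : E} {J : E →L[ℝ] E} (ha : AnalyticAt ℝ f x) (hf : HasFDerivAt f J x) :
    ∃ C > 0, ∃ δ > 0, ∀ y, ‖y - x‖ ≤ δ → ‖f y - f x - J (y - x)‖ ≤ C * ‖y - x‖ ^ 2 := by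
  obtain ⟨p, hp⟩ := ha
  have hJ := hf.unique hp.hasFDerivAt
  obtain ⟨C, hC, hb⟩ := (hp.isBigO_sub_partialSum_pow 2).exists_pos
  obtain ⟨δ, hδ, hball⟩ := Metric.eventually_nhds_iff.1 hb.bound
  refine ⟨C, hC, δ / 2, half_pos hδ, fun y hy => ?_⟩
  have h := hball (y := y - x) (by rw [dist_zero_right]; linarith)
  have hsum : p.partialSum 2 (y - x) = f x + J (y - x) := by
    rw [FormalMultilinearSeries.partialSum, Finset.sum_range_succ, Finset.sum_range_one, hJ]
    congr 1
    exact hp.coeff_zero _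
  rw [hsum, add_sub_cancel, norm_pow, norm_norm] at h
  rwa [sub_sub]

/-- Discrete Duhamel formula: the deviation of an orbit is the linear evolution of the initial
deviation plus the propagated nonlinear remainders. -/
theorem iterate_sub_eq_duhamel {E : Type*} [NormedAddCommGroup E] [NormedSpace ℝ E]
    (f : E → E) (x : E) (J : E →L[ℝ] E) (y : E) (n : ℕ) :
    f^[n] y - x = (J ^ n) (y - x) + ∑ j ∈ Finset.range n,
      (J ^ (n - 1 - j)) (f (f^[j] y) - x - J (f^[j] y - x)) := by
  induction n with
  | zero => simp
  | succ n ih =>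
    have h : f^[n + 1] y - x = J (f^[n] y - x) + (f (f^[n] y) - x - J (f^[n] y - x)) := by
      rw [Function.iterate_succ_apply']; abel
    have hJ : J (f^[n] y - x) = J ((J ^ n) (y - x)) + ∑ j ∈ Finset.range n,
        J ((J ^ (n - 1 - j)) (f (f^[j] y) - x - J (f^[j] y - x))) := by
      conv_lhs => rw [ih]
      rw [map_add, map_sum]
    rw [h, Finset.sum_range_succ]
    nth_rewrite 1 [hJ]
    rw [add_assoc]
    have h1 : ∀ z, J ((J ^ n) z) = (J ^ (n + 1)) z := fun z => by rw [pow_succ']; rfl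
    rw [h1]
    congr 2
    · refine Finset.sum_congr rfl fun j hj => ?_
      have : n + 1 - 1 - j = (n - 1 - j) + 1 := by
        have := Finset.mem_range.1 hj; omega
      rw [this, pow_succ']; rfl
    · simp

/-- Instability from directions `w` along which `J ^ n` has the exact growth rate `r > 1`, when the
growth of `J ^ n` is bounded by `s ^ n` for some `s < r ^ 2`: the remainders, of size
`(ε r ^ j) ^ 2` at time `j`, are then summed to a multiple of `(ε r ^ n) ^ 2`. The direction may
depend on the time `n`, so that a complex eigenvalue of `J` can be used without its phase
mattering. -/
theorem not_lyapunovStable_of_growth {E : Type*} [NormedAddCommGroup E] [NormedSpace ℝ E]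
    {f : E → E} {x : E} {J : E →L[ℝ] E} (ha : AnalyticAt ℝ f x) (hf : HasFDerivAt f J x)
    {r s c C₁ : ℝ} (hr : 1 < r) (hs : 0 ≤ s) (hsr : s < r ^ 2) (hc : 0 < c)
    (hJ : ∀ n, ‖J ^ n‖ ≤ C₁ * s ^ n)
    (hw : ∀ n, ∃ w, (∀ k, ‖(J ^ k) w‖ ≤ r ^ k) ∧ c * r ^ n ≤ ‖(J ^ n) w‖) :
    ¬ LyapunovStable f x := by
  rintro ⟨hx, hst⟩
  obtain ⟨C, hC, δ, hδ, hrem⟩ := ha.exists_quadratic_remainder hf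
  rw [hx] at hrem
  have hr0 : 0 < r := zero_lt_one.trans hr
  have hC₁ : 0 ≤ C₁ := by simpa using (norm_nonneg _).trans (hJ 0)
  have hgap : 0 < r ^ 2 - s := sub_pos.2 hsr
  obtain ⟨D, hD, hD0⟩ : ∃ D, 4 * C * C₁ / (r ^ 2 - s) ≤ D ∧ 0 < D :=
    ⟨_, le_max_left _ 1, lt_max_of_lt_right one_pos⟩
  obtain ⟨η, hη, hη1, hη2, hη3⟩ : ∃ η > 0, D * η ≤ 1 ∧ 2 * η ≤ δ ∧ D * η ≤ c / 2 := by
    refine ⟨min (1 / D) (min (δ / 2) (c / 2 / D)), by positivity, ?_, ?_, ?_⟩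
    · rw [← le_div_iff₀' hD0]; exact min_le_left _ _
    · rw [← le_div_iff₀' two_pos]; exact (min_le_right _ _).trans (min_le_left _ _)
    · rw [← le_div_iff₀' hD0]; exact (min_le_right _ _).trans (min_le_right _ _)
  obtain ⟨ρ, hρ, hball⟩ := Metric.eventually_nhds_iff.1
    (hst (Metric.ball x (η * c / 2)) (Metric.ball_mem_nhds _ (by positivity)))
  obtain ⟨n, hn⟩ : ∃ n : ℕ, η / r ^ n < ρ := by
    obtain ⟨n, hn⟩ := pow_unbounded_of_one_lt (η / ρ) hr
    exact ⟨n, by rw [div_lt_iff₀ (by positivity)]; rwa [div_lt_iff₀' hρ] at hn⟩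
  obtain ⟨w, hwk, hwn⟩ := hw n
  -- the initial size is such that the linear part has size of order `η` at time `n`
  set ε := η / r ^ n with hε
  have hε0 : 0 < ε := by positivity
  have hεn : ε * r ^ n = η := by rw [hε]; field_simp
  have hεk : ∀ k ≤ n, ε * r ^ k ≤ η := fun k hk => by
    rw [← hεn]; gcongr; exact hr.le
  set y := x + ε • w with hy
  have hyx : y - x = ε • w := by rw [hy]; abel
  have hlin : ∀ k, (J ^ k) (y - x) = ε • (J ^ k) w := fun k => by rw [hyx, map_smul]
  have key : ∀ k ≤ n, ‖f^[k] y - x - (J ^ k) (y - x)‖ ≤ D * (ε * r ^ k) ^ 2 := by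
    intro k
    induction k using Nat.strong_induction_on with
    | _ k ih =>
      intro hk
      have hsize : ∀ j < k, ‖f^[j] y - x‖ ≤ 2 * (ε * r ^ j) := by
        intro j hj
        have hjn : j ≤ n := hj.le.trans hk
        have h1 := ih j hj hjn
        have h2 : ‖(J ^ j) (y - x)‖ ≤ ε * r ^ j := by
          rw [hlin, norm_smul, Real.norm_of_nonneg hε0.le]
          gcongr
          exact hwk j
        have h3 : D * (ε * r ^ j) ^ 2 ≤ ε * r ^ j := by
          have h4 : D * (ε * r ^ j) ≤ 1 := by
            refine le_trans ?_ hη1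
            gcongr
            exact hεk j hjn
          have h5 : 0 ≤ ε * r ^ j := by positivity
          nlinarith
        have h6 := norm_sub_norm_le (f^[j] y - x) ((J ^ j) (y - x))
        linarith
      have hR : ∀ j < k, ‖f (f^[j] y) - x - J (f^[j] y - x)‖ ≤ 4 * C * ε ^ 2 * (r ^ 2) ^ j := by
        intro j hj
        have h1 := hsize j hj
        have h2 := hεk j (hj.le.trans hk)
        refine (hrem _ (by linarith)).trans ?_
        calc C * ‖f^[j] y - x‖ ^ 2 ≤ C * (2 * (ε * r ^ j)) ^ 2 := by gcongr
          _ = _ := by ring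
      rw [iterate_sub_eq_duhamel f x J y k, add_sub_cancel_left]
      calc ‖∑ j ∈ Finset.range k, (J ^ (k - 1 - j)) (f (f^[j] y) - x - J (f^[j] y - x))‖
          ≤ ∑ j ∈ Finset.range k, C₁ * s ^ (k - 1 - j) * (4 * C * ε ^ 2 * (r ^ 2) ^ j) := by
            refine (norm_sum_le _ _).trans (Finset.sum_le_sum fun j hj => ?_)
            refine ((J ^ (k - 1 - j)).le_opNorm _).trans ?_
            exact mul_le_mul (hJ _) (hR j (Finset.mem_range.1 hj)) (norm_nonneg _) (by positivity)
        _ = 4 * C * C₁ * ε ^ 2 * ∑ j ∈ Finset.range k, (r ^ 2) ^ j * s ^ (k - 1 - j) := by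
            rw [Finset.mul_sum]
            exact Finset.sum_congr rfl fun j _ => by ring
        _ = 4 * C * C₁ / (r ^ 2 - s) * ε ^ 2 * ((r ^ 2) ^ k - s ^ k) := by
            rw [← (Commute.all (r ^ 2) s).geom_sum₂_mul]
            field_simp
        _ ≤ D * ε ^ 2 * (r ^ 2) ^ k := by
            gcongr
            · have h1 : s ^ k ≤ (r ^ 2) ^ k := pow_le_pow_left₀ hs hsr.le k
              linarith
            · have : 0 ≤ s ^ k := by positivity
              linarith
        _ = D * (ε * r ^ k) ^ 2 := by ring
  have hlow : η * c ≤ ‖(J ^ n) (y - x)‖ := by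
    rw [hlin, norm_smul, Real.norm_of_nonneg hε0.le, ← hεn]
    calc ε * r ^ n * c = ε * (c * r ^ n) := by ring
      _ ≤ _ := by gcongr
  have h1 := key n le_rfl
  rw [hεn] at h1
  have h2 := norm_sub_norm_le ((J ^ n) (y - x)) (f^[n] y - x)
  rw [norm_sub_rev ((J ^ n) (y - x))] at h2
  have h3 : ‖f^[n] y - x‖ < η * c / 2 := by
    have h4 := hball (y := y) (by
      rw [dist_eq_norm, hyx, norm_smul, Real.norm_of_nonneg hε0.le]
      have := hwk 0
      simp only [pow_zero, one_apply_eq_self] at this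
      nlinarith) n
    rwa [Metric.mem_ball, dist_eq_norm] at h4
  nlinarith

/-! ### Growth of the powers of a real matrix -/

section Perron

variable {E : Type*} [Fintype E] [DecidableEq E]

theorem perronEigenvalue_nonneg (A : Matrix E E ℝ) : 0 ≤ perronEigenvalue A :=
  ENNReal.toReal_nonneg

theorem Matrix.map_ofReal_pow_mulVec (A : Matrix E E ℝ) (n : ℕ) (w : E → ℝ) :
    (A.map (fun r : ℝ => (r : ℂ))) ^ n *ᵥ (fun e => (w e : ℂ)) =
      fun e => (((A ^ n *ᵥ w) e : ℝ) : ℂ) := by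
  have h : (A.map (fun r : ℝ => (r : ℂ))) ^ n = (A ^ n).map (fun r : ℝ => (r : ℂ)) :=
    (Matrix.map_pow A Complex.ofRealHom n).symm
  rw [h]
  exact (funext fun e => RingHom.map_mulVec Complex.ofRealHom (A ^ n) w e).symm

/-- The powers of `A` grow at most like `ρ ^ n` for `ρ` larger than the spectral radius, by
Gelfand's formula. -/
theorem exists_norm_pow_mulVec_le (A : Matrix E E ℝ) {ρ : ℝ} (hρ : perronEigenvalue A < ρ) :
    ∃ C, 0 ≤ C ∧ ∀ n (w : E → ℝ), ‖A ^ n *ᵥ w‖ ≤ C * ρ ^ n * ‖w‖ := by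
  let _ : NormedRing (Matrix E E ℂ) := Matrix.linftyOpNormedRing
  let _ : NormedAlgebra ℂ (Matrix E E ℂ) := Matrix.linftyOpNormedAlgebra
  have hρ0 : 0 < ρ := (perronEigenvalue_nonneg A).trans_lt hρ
  set A' := A.map (fun r : ℝ => (r : ℂ)) with hA'
  have : CompleteSpace (Matrix E E ℂ) := FiniteDimensional.complete ℂ _
  have hfin : spectralRadius ℂ A' ≠ ⊤ := by
    refine ne_top_of_le_ne_top ENNReal.coe_ne_top (iSup₂_le fun k hk => ?_ :
      spectralRadius ℂ A' ≤ ((‖A'‖₊ * ‖(1 : Matrix E E ℂ)‖₊ : NNReal) : ENNReal))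
    exact mod_cast spectrum.norm_le_norm_mul_of_mem hk
  have hlim : Tendsto (fun n : ℕ => ‖A' ^ n‖ ^ (1 / n : ℝ)) atTop (𝓝 (perronEigenvalue A)) := by
    have h := (ENNReal.tendsto_toReal hfin).comp
      (spectrum.pow_norm_pow_one_div_tendsto_nhds_spectralRadius A')
    refine h.congr fun n => ?_
    exact ENNReal.toReal_ofReal (by positivity)
  have hev : ∀ᶠ n : ℕ in atTop, ‖A' ^ n‖ ≤ ρ ^ n := by
    filter_upwards [hlim.eventually_lt_const hρ, eventually_ge_atTop 1] with n hn hn1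
    have h := pow_le_pow_left₀ (by positivity) hn.le n
    rwa [one_div, Real.rpow_inv_natCast_pow (norm_nonneg _) (by omega)] at h
  obtain ⟨N, hN⟩ := eventually_atTop.1 hev
  refine ⟨1 + ∑ j ∈ Finset.range N, ‖A' ^ j‖ / ρ ^ j, by positivity, fun n w => ?_⟩
  have hn : ‖A' ^ n‖ ≤ (1 + ∑ j ∈ Finset.range N, ‖A' ^ j‖ / ρ ^ j) * ρ ^ n := by
    rcases le_or_gt N n with h | h
    · refine (hN n h).trans (le_mul_of_one_le_left (by positivity) ?_)
      exact le_add_of_nonneg_right (Finset.sum_nonneg fun _ _ => by positivity)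
    · rw [← div_le_iff₀ (by positivity)]
      have h1 := Finset.single_le_sum (f := fun j => ‖A' ^ j‖ / ρ ^ j)
        (fun _ _ => by positivity) (Finset.mem_range.2 h)
      linarith
  have hreal : ∀ v : E → ℝ, ‖(fun e => (v e : ℂ))‖ = ‖v‖ := fun v => by
    simp [Pi.norm_def]
  rw [← hreal w, ← hreal (A ^ n *ᵥ w), ← Matrix.map_ofReal_pow_mulVec]
  refine (Matrix.linfty_opNorm_mulVec (A' ^ n) _).trans ?_
  gcongr

/-- Real vectors whose images by the powers of `A` have the exact growth rate given by the spectral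
radius. They are real parts of multiples of a complex eigenvector `z` for an eigenvalue `μ` of maximal
modulus. -/
theorem exists_norm_pow_mulVec_ge [Nonempty E] (A : Matrix E E ℝ) :
    ∃ c > 0, ∀ n, ∃ w : E → ℝ, (∀ k, ‖A ^ k *ᵥ w‖ ≤ perronEigenvalue A ^ k) ∧
      c * perronEigenvalue A ^ n ≤ ‖A ^ n *ᵥ w‖ := by
  let _ : NormedRing (Matrix E E ℂ) := Matrix.linftyOpNormedRing
  let _ : NormedAlgebra ℂ (Matrix E E ℂ) := Matrix.linftyOpNormedAlgebra
  set A' := A.map (fun r : ℝ => (r : ℂ)) with hA'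
  have : CompleteSpace (Matrix E E ℂ) := FiniteDimensional.complete ℂ _
  obtain ⟨μ, hμ, hμr⟩ := spectrum.exists_nnnorm_eq_spectralRadius A'
  have hμn : ‖μ‖ = perronEigenvalue A := by
    rw [perronEigenvalue, ← hA', ← hμr]; rfl
  rw [← Matrix.spectrum_toLin', ← Module.End.hasEigenvalue_iff_mem_spectrum] at hμ
  obtain ⟨z, hz⟩ := hμ.exists_hasEigenvector
  have hz0 : z ≠ 0 := hz.2
  obtain ⟨e₀, he₀⟩ := Function.ne_iff.1 hz0
  have hpow : ∀ k, A' ^ k *ᵥ z = μ ^ k • z := by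
    intro k
    have := hz.pow_apply k
    rwa [← Matrix.toLin'_pow, Matrix.toLin'_apply] at this
  have hzn : 0 < ‖z‖ := norm_pos_iff.2 hz0
  refine ⟨‖z e₀‖ / ‖z‖, div_pos (norm_pos_iff.2 he₀) hzn, fun n => ?_⟩
  -- the phase `θ` makes the coordinate `e₀` of `A ^ n (θ z)` real, so that it survives in the real part
  obtain ⟨θ, hθ, hθz⟩ : ∃ θ : ℂ, ‖θ‖ = 1 ∧ θ * (μ ^ n * z e₀) = ‖μ ^ n * z e₀‖ := by
    rcases eq_or_ne (μ ^ n * z e₀) 0 with h | h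
    · exact ⟨1, by simp, by simp [h]⟩
    · refine ⟨‖μ ^ n * z e₀‖ / (μ ^ n * z e₀), ?_, div_mul_cancel₀ _ h⟩
      rw [norm_div, Complex.norm_real, norm_norm, div_self (norm_ne_zero_iff.2 h)]
  set w : E → ℝ := fun e => (θ / ‖z‖ * z e).re with hw
  have hAw : ∀ k e, (A ^ k *ᵥ w) e = (θ / ‖z‖ * (μ ^ k * z e)).re := by
    intro k e
    have h1 : (A' ^ k *ᵥ ((θ / ‖z‖) • z)) e = θ / ‖z‖ * (μ ^ k * z e) := by
      rw [Matrix.mulVec_smul, hpow]; simp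
    rw [← h1]
    have h2 : A' ^ k = (A ^ k).map (fun r : ℝ => (r : ℂ)) :=
      (Matrix.map_pow A Complex.ofRealHom k).symm
    rw [h2]
    simp only [Matrix.mulVec, dotProduct, Matrix.map_apply, Complex.re_sum, Complex.re_ofReal_mul]
    rfl
  refine ⟨w, fun k => ?_, ?_⟩
  · rw [pi_norm_le_iff_of_nonneg (pow_nonneg (perronEigenvalue_nonneg A) k)]
    intro e
    rw [hAw, ← hμn]
    refine (Complex.abs_re_le_norm _).trans ?_
    rw [norm_mul, norm_div, hθ, Complex.norm_real, norm_norm, norm_mul, norm_pow]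
    have : ‖z e‖ ≤ ‖z‖ := norm_le_pi_norm z e
    calc 1 / ‖z‖ * (‖μ‖ ^ k * ‖z e‖) ≤ 1 / ‖z‖ * (‖μ‖ ^ k * ‖z‖) := by gcongr
      _ = ‖μ‖ ^ k := by field_simp
  · refine le_trans ?_ (norm_le_pi_norm (A ^ n *ᵥ w) e₀)
    rw [hAw, div_mul_eq_mul_div θ, hθz, ← Complex.ofReal_div, Complex.ofReal_re, norm_mul, norm_pow,
      hμn, Real.norm_eq_abs]
    refine le_trans (le_of_eq ?_) (le_abs_self _)
    ring

end Perron

/-! ### The second eigenvalue of a reversible kernel -/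

section SecondEigenvalue

variable {q : ℕ}

/-- An orthonormal eigenbasis in which `i₀` and `i₁` are the indices of the two largest eigenvalues. -/
theorem Matrix.IsHermitian.exists_sorted_eigenbasis {S : Matrix (Fin q) (Fin q) ℝ}
    (hS : S.IsHermitian) (hq : 2 ≤ q) :
    ∃ (lam : Fin q → ℝ) (u : Fin q → Fin q → ℝ) (i₀ i₁ : Fin q),
      (∀ i, S *ᵥ u i = lam i • u i) ∧ (∀ i j, u i ⬝ᵥ u j = if i = j then 1 else 0) ∧
      (∀ x y, x ⬝ᵥ y = ∑ i, (u i ⬝ᵥ x) * (u i ⬝ᵥ y)) ∧ i₀ ≠ i₁ ∧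
      secondEigenvalue S = lam i₁ ∧ lam i₁ ≤ lam i₀ ∧ ∀ i ≠ i₀, lam i ≤ lam i₁ := by
  have hc : Fintype.card (Fin q) = q := Fintype.card_fin q
  set τ : Fin (Fintype.card (Fin q)) ≃ Fin q := Fintype.equivOfCardEq (Fintype.card_fin _) with hτ
  have hlam : ∀ j, hS.eigenvalues (τ j) = hS.eigenvalues₀ j := fun j => by
    rw [Matrix.IsHermitian.eigenvalues, ← hτ, Equiv.symm_apply_apply]
  have hinner : ∀ x y : EuclideanSpace ℝ (Fin q), inner ℝ x y = ⇑x ⬝ᵥ ⇑y := fun x y => by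
    rw [EuclideanSpace.inner_eq_star_dotProduct, dotProduct_comm]; rfl
  let j₀ : Fin (Fintype.card (Fin q)) := ⟨0, by omega⟩
  let j₁ : Fin (Fintype.card (Fin q)) := ⟨1, by omega⟩
  refine ⟨hS.eigenvalues, fun i => ⇑(hS.eigenvectorBasis i), τ j₀, τ j₁,
    hS.mulVec_eigenvectorBasis, fun i j => ?_, fun x y => ?_, ?_, ?_, ?_, fun i hi => ?_⟩
  · rw [← hinner]
    exact orthonormal_iff_ite.1 hS.eigenvectorBasis.orthonormal i j
  · have h := hS.eigenvectorBasis.sum_inner_mul_inner (WithLp.toLp 2 x) (WithLp.toLp 2 y)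
    simp only [hinner] at h
    rw [← h]
    exact Finset.sum_congr rfl fun i _ => by rw [dotProduct_comm]
  · intro h
    have := congrArg Fin.val (τ.injective h)
    simp [j₀, j₁] at this
  · have h := hS.sort_roots_charpoly_eq_eigenvalues₀
    have hre : (S.charpoly.roots.map RCLike.re : Multiset ℝ) = S.charpoly.roots := by
      simp
    rw [hre] at h
    rw [secondEigenvalue, h, hlam, List.getD_eq_getElem _ _ (by simp; omega), List.getElem_ofFn]
  · rw [hlam, hlam]
    exact hS.eigenvalues₀_antitone (by simp [j₀, j₁, Fin.le_def])
  · obtain ⟨j, rfl⟩ := τ.surjective i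
    rw [hlam, hlam]
    refine hS.eigenvalues₀_antitone ?_
    rw [Fin.le_def]
    have : j.val ≠ 0 := fun h => hi (congrArg τ (Fin.ext h))
    show 1 ≤ j.val
    omega

theorem Matrix.IsHermitian.dotProduct_mulVec_comm {S : Matrix (Fin q) (Fin q) ℝ}
    (hS : S.IsHermitian) (x y : Fin q → ℝ) : x ⬝ᵥ S *ᵥ y = (S *ᵥ x) ⬝ᵥ y := by
  have h : Sᵀ = S := by simpa [Matrix.IsHermitian] using hS
  rw [Matrix.dotProduct_mulVec, ← Matrix.mulVec_transpose, h]

variable {S : Matrix (Fin q) (Fin q) ℝ} {h : Fin q → ℝ}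

/-- The second eigenvalue bounds the quadratic form of `S` on the orthogonal of a fixed vector `h`,
when `S ≤ 1`. -/
theorem Matrix.IsHermitian.dotProduct_mulVec_le_secondEigenvalue (hS : S.IsHermitian)
    (hh : h ≠ 0) (hSh : S *ᵥ h = h) (hle : ∀ y, y ⬝ᵥ S *ᵥ y ≤ y ⬝ᵥ y) (hq : 2 ≤ q)
    {y : Fin q → ℝ} (hy : h ⬝ᵥ y = 0) :
    y ⬝ᵥ S *ᵥ y ≤ secondEigenvalue S * (y ⬝ᵥ y) := by
  obtain ⟨lam, u, i₀, i₁, hu, hon, hexp, -, hsec, h10, hmax⟩ := hS.exists_sorted_eigenbasis hq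
  have hlam1 : ∀ i, lam i ≤ 1 := fun i => by
    have := hle (u i)
    rwa [hu, dotProduct_smul, hon, if_pos rfl, smul_eq_mul, mul_one] at this
  have hSu : ∀ i x, u i ⬝ᵥ S *ᵥ x = lam i * (u i ⬝ᵥ x) := fun i x => by
    rw [hS.dotProduct_mulVec_comm, hu, smul_dotProduct, smul_eq_mul]
  rw [hsec, hexp y (S *ᵥ y), hexp y y, Finset.mul_sum]
  refine Finset.sum_le_sum fun i _ => ?_
  rw [hSu]
  -- if the second eigenvalue is less than `1`, then `h` is proportional to the top eigenvector
  suffices H : i ≠ i₀ ∨ u i ⬝ᵥ y = 0 ∨ lam i₁ = 1 by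
    rcases H with H | H | H
    · nlinarith [hmax i H, mul_self_nonneg (u i ⬝ᵥ y)]
    · simp [H]
    · nlinarith [hlam1 i, mul_self_nonneg (u i ⬝ᵥ y)]
  by_contra! H
  obtain ⟨rfl, hy0, hl⟩ := H
  have hl' : lam i₁ < 1 := lt_of_le_of_ne (hlam1 _) hl
  have hd : ∀ j ≠ i, u j ⬝ᵥ h = 0 := fun j hj => by
    have h1 := hSu j h
    rw [hSh] at h1
    have h2 := hmax j hj
    have h3 : (1 - lam j) * (u j ⬝ᵥ h) = 0 := by linarith
    exact (mul_eq_zero.1 h3).resolve_left (by linarith)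
  have h1 : ∀ x, h ⬝ᵥ x = (u i ⬝ᵥ h) * (u i ⬝ᵥ x) := fun x => by
    rw [hexp h x]
    exact Finset.sum_eq_single i (fun j _ hj => by rw [hd j hj, zero_mul]) (by simp)
  have h2 : u i ⬝ᵥ h = 0 := (mul_eq_zero.1 ((h1 y).symm.trans hy)).resolve_right hy0
  refine hh (dotProduct_self_eq_zero.1 ?_)
  rw [h1, h2, zero_mul]

/-- The second eigenvalue has an eigenvector that is not a multiple of the fixed vector `h`: if `u i₁`
is a multiple of `h`, then both largest eigenvalues are `1` and `u i₀` is not one. -/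
theorem Matrix.IsHermitian.exists_eigenvector_secondEigenvalue (hS : S.IsHermitian)
    (hle : ∀ y, y ⬝ᵥ S *ᵥ y ≤ y ⬝ᵥ y) (hSh : S *ᵥ h = h) (hq : 2 ≤ q) :
    ∃ v, S *ᵥ v = secondEigenvalue S • v ∧ ∀ c : ℝ, v ≠ c • h := by
  obtain ⟨lam, u, i₀, i₁, hu, hon, -, h01, hsec, h10, -⟩ := hS.exists_sorted_eigenbasis hq
  have hlam1 : ∀ i, lam i ≤ 1 := fun i => by
    have := hle (u i)
    rwa [hu, dotProduct_smul, hon, if_pos rfl, smul_eq_mul, mul_one] at this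
  rw [hsec]
  by_cases H : ∀ c : ℝ, u i₁ ≠ c • h
  · exact ⟨u i₁, hu i₁, H⟩
  · push Not at H
    obtain ⟨c, hc⟩ := H
    have hne : u i₁ ≠ 0 := fun h0 => by
      have := hon i₁ i₁
      simp [h0] at this
    have h1 : lam i₁ = 1 := by
      have h2 := hu i₁
      rw [hc, Matrix.mulVec_smul, hSh, ← hc] at h2
      have h3 : (lam i₁ - 1) • u i₁ = 0 := by rw [sub_smul, ← h2, one_smul, sub_self]
      have := (smul_eq_zero.1 h3).resolve_right hne
      linarith
    have h2 : lam i₀ = lam i₁ := le_antisymm (by rw [h1]; exact hlam1 _) h10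
    refine ⟨u i₀, by rw [← h2]; exact hu i₀, fun d hd => ?_⟩
    have h3 := hon i₁ i₀
    have h4 := hon i₀ i₀
    have h5 := hon i₁ i₁
    rw [if_neg h01.symm] at h3
    rw [if_pos rfl] at h4 h5
    rw [hd] at h3 h4
    rw [hc] at h3 h5
    simp only [smul_dotProduct, dotProduct_smul, smul_eq_mul] at h3 h4 h5
    have : (c * (c * (h ⬝ᵥ h))) * (d * (d * (h ⬝ᵥ h))) = (c * (d * (h ⬝ᵥ h))) ^ 2 := by ring
    have h6 : c * (d * (h ⬝ᵥ h)) = 0 := by linarith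
    rw [h4, h5, h6] at this
    norm_num at this

/-- The conjugate `D K D⁻¹` with `D = diag (√b)`: it is symmetric when `K` is reversible with respect
to `b`, and has the spectrum of `K`. -/
def symmetrization (b : Fin q → ℝ) (K : Matrix (Fin q) (Fin q) ℝ) : Matrix (Fin q) (Fin q) ℝ :=
  Matrix.diagonal (fun k => √(b k)) * (K * Matrix.diagonal (fun k => (√(b k))⁻¹))

variable {b : Fin q → ℝ} {K : Matrix (Fin q) (Fin q) ℝ}

theorem symmetrization_apply (k l : Fin q) :
    symmetrization b K k l = √(b k) * K k l * (√(b l))⁻¹ := by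
  rw [symmetrization, Matrix.diagonal_mul, Matrix.mul_diagonal, mul_assoc]

theorem secondEigenvalue_symmetrization (hb : ∀ k, 0 < b k) :
    secondEigenvalue (symmetrization b K) = secondEigenvalue K := by
  have h : Matrix.diagonal (fun k => (√(b k))⁻¹) * Matrix.diagonal (fun k => √(b k)) = 1 := by
    rw [Matrix.diagonal_mul_diagonal, ← Matrix.diagonal_one]
    congr 1
    ext k
    exact inv_mul_cancel₀ (Real.sqrt_pos.2 (hb k)).ne'
  rw [secondEigenvalue, symmetrization, Matrix.charpoly_mul_comm, Matrix.mul_assoc, h,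
    Matrix.mul_one, secondEigenvalue]

theorem isHermitian_symmetrization (hb : ∀ k, 0 < b k)
    (hrev : ∀ k l, b k * K k l = b l * K l k) : (symmetrization b K).IsHermitian := by
  ext k l
  rw [Matrix.conjTranspose_apply, star_trivial, symmetrization_apply, symmetrization_apply]
  have hk := Real.sqrt_pos.2 (hb k)
  have hl := Real.sqrt_pos.2 (hb l)
  have := hrev k l
  rw [← Real.mul_self_sqrt (hb k).le, ← Real.mul_self_sqrt (hb l).le] at this
  field_simp
  linarith

theorem symmetrization_mulVec (hb : ∀ k, 0 < b k) (g : Fin q → ℝ) :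
    symmetrization b K *ᵥ (fun k => √(b k) * g k) = fun k => √(b k) * (K *ᵥ g) k := by
  ext k
  simp only [Matrix.mulVec, dotProduct, symmetrization_apply, Finset.mul_sum]
  refine Finset.sum_congr rfl fun l _ => ?_
  have := (Real.sqrt_pos.2 (hb l)).ne'
  field_simp

theorem sqrt_mul_dotProduct (hb : ∀ k, 0 < b k) (g g' : Fin q → ℝ) :
    (fun k => √(b k) * g k) ⬝ᵥ (fun k => √(b k) * g' k) = ∑ k, b k * (g k * g' k) := by
  refine Finset.sum_congr rfl fun k _ => ?_
  rw [← Real.mul_self_sqrt (hb k).le]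
  ring

theorem exists_eq_sqrt_mul (hb : ∀ k, 0 < b k) (y : Fin q → ℝ) :
    ∃ g : Fin q → ℝ, y = fun k => √(b k) * g k :=
  ⟨fun k => y k / √(b k), funext fun k => (mul_div_cancel₀ _ (Real.sqrt_pos.2 (hb k)).ne').symm⟩

theorem sum_mul_mulVec_le_secondEigenvalue (hb : ∀ k, 0 < b k)
    (hrev : ∀ k l, b k * K k l = b l * K l k) (hrow : ∀ k, ∑ l, K k l = 1)
    (hle : ∀ g : Fin q → ℝ, ∑ k, b k * (g k * (K *ᵥ g) k) ≤ ∑ k, b k * (g k * g k))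
    (hq : 2 ≤ q) {g : Fin q → ℝ} (hg : ∑ k, b k * g k = 0) :
    ∑ k, b k * (g k * (K *ᵥ g) k) ≤ secondEigenvalue K * ∑ k, b k * (g k * g k) := by
  have hK1 : K *ᵥ (fun _ => 1) = fun _ => 1 := by
    ext k; simp [Matrix.mulVec, dotProduct, hrow]
  rw [← secondEigenvalue_symmetrization hb, ← sqrt_mul_dotProduct hb, ← sqrt_mul_dotProduct hb,
    ← symmetrization_mulVec hb]
  refine (isHermitian_symmetrization hb hrev).dotProduct_mulVec_le_secondEigenvalue
    (h := fun k => √(b k) * 1) ?_ ?_ ?_ hq ?_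
  · intro h
    have := congrFun h ⟨0, by omega⟩
    simp only [mul_one, Pi.zero_apply] at this
    exact (Real.sqrt_pos.2 (hb _)).ne' this
  · rw [symmetrization_mulVec hb, hK1]
  · intro y
    obtain ⟨g, rfl⟩ := exists_eq_sqrt_mul hb y
    rw [symmetrization_mulVec hb, sqrt_mul_dotProduct hb, sqrt_mul_dotProduct hb]
    exact hle g
  · rw [sqrt_mul_dotProduct hb]
    simpa using hg

theorem exists_nonconstant_eigenvector_secondEigenvalue (hb : ∀ k, 0 < b k)
    (hrev : ∀ k l, b k * K k l = b l * K l k) (hrow : ∀ k, ∑ l, K k l = 1)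
    (hle : ∀ g : Fin q → ℝ, ∑ k, b k * (g k * (K *ᵥ g) k) ≤ ∑ k, b k * (g k * g k))
    (hq : 2 ≤ q) :
    ∃ v : Fin q → ℝ, K *ᵥ v = secondEigenvalue K • v ∧ ∀ c : ℝ, v ≠ fun _ => c := by
  have hK1 : K *ᵥ (fun _ => 1) = fun _ => 1 := by
    ext k; simp [Matrix.mulVec, dotProduct, hrow]
  obtain ⟨y, hy, hyc⟩ :=
    (isHermitian_symmetrization hb hrev).exists_eigenvector_secondEigenvalue
    (h := fun k => √(b k) * 1) (fun y => by
      obtain ⟨g, rfl⟩ := exists_eq_sqrt_mul hb y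
      rw [symmetrization_mulVec hb, sqrt_mul_dotProduct hb, sqrt_mul_dotProduct hb]
      exact hle g) (by rw [symmetrization_mulVec hb, hK1]) hq
  obtain ⟨v, rfl⟩ := exists_eq_sqrt_mul hb y
  rw [symmetrization_mulVec hb, secondEigenvalue_symmetrization hb] at hy
  refine ⟨v, funext fun k => ?_, fun c hc => hyc c ?_⟩
  · have h := congrFun hy k
    simp only [Pi.smul_apply, smul_eq_mul] at h ⊢
    have := (Real.sqrt_pos.2 (hb k)).ne'
    refine mul_left_cancel₀ this ?_
    rw [h]; ring
  · ext k
    simp [hc, mul_comm]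

/-- An eigenvector of `B²` for `s²` gives one of `B` for `s` or `-s`, through the factorization
`B² - s² = (B - s) (B + s)`; constants are handled with `B 1 = 1`. -/
theorem exists_nonconstant_eigenvector_of_sq {B : Matrix (Fin q) (Fin q) ℝ}
    (hrow : ∀ k, ∑ l, B k l = 1) {s : ℝ} (hs : 0 ≤ s) {v : Fin q → ℝ}
    (hv : (B * B) *ᵥ v = (s * s) • v) (hvc : ∀ c : ℝ, v ≠ fun _ => c) :
    ∃ (ν : ℝ) (v' : Fin q → ℝ), |ν| = s ∧ B *ᵥ v' = ν • v' ∧ ∀ c : ℝ, v' ≠ fun _ => c := by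
  have hB1 : ∀ c : ℝ, B *ᵥ (fun _ => c) = fun _ => c := fun c => by
    ext k
    simp only [Matrix.mulVec, dotProduct]
    rw [← Finset.sum_mul, hrow, one_mul]
  rw [← Matrix.mulVec_mulVec] at hv
  by_cases H : ∀ c : ℝ, B *ᵥ v + s • v ≠ fun _ => c
  · refine ⟨s, _, abs_of_nonneg hs, ?_, H⟩
    rw [Matrix.mulVec_add, Matrix.mulVec_smul, hv]
    module
  · push Not at H
    obtain ⟨c, hc⟩ := H
    refine ⟨-s, fun k => v k - c / (1 + s), by rw [abs_neg, abs_of_nonneg hs], ?_, fun d hd => ?_⟩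
    · have h1 : (fun k => v k - c / (1 + s)) = v - fun _ => c / (1 + s) := rfl
      rw [h1, Matrix.mulVec_sub, hB1]
      ext k
      have := congrFun hc k
      simp only [Pi.add_apply, Pi.smul_apply, Pi.sub_apply, smul_eq_mul] at this ⊢
      field_simp
      linear_combination (1 + s) * this
    · refine hvc (d + c / (1 + s)) (funext fun k => ?_)
      have : v k - c / (1 + s) = d := congrFun hd k
      linarith

end SecondEigenvalue

namespace MarkovField

variable {V F : Type*} {q : ℕ} [Fintype V] [DecidableEq V] [Fintype F] [DecidableEq F]
  (M : MarkovField V F q) {m : M.Messages}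

/-! ### Consistency of the beliefs at a fixed point -/

/-- The summand `ψ_a(x_a) ∏_{j ∈ a, j ≠ i} n_{j → a}(x_j)` of `Θ_{ai,k}`, for `e = (a, i)`. -/
def cavityWeight (m : M.Messages) (e : M.Edge) (x : {j // j ∈ M.scope e.1.1} → Fin q) : ℝ :=
  M.ψ e.1.1 x * ∏ j : {j // j ∈ M.scope e.1.1} with j.1 ≠ e.1.2, M.varMessage m j.1 e.1.1 (x j)

theorem theta_eq_sum_cavityWeight (m : M.Messages) (e : M.Edge) (k : Fin q) :
    M.theta m e k = ∑ x with x ⟨e.1.2, e.2⟩ = k, M.cavityWeight m e x := rfl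

theorem varMessage_pos (hpos : ∀ e k, 0 < m e k) (j : V) (a : F) (k : Fin q) :
    0 < M.varMessage m j a k :=
  mul_pos (M.φ_pos j k) (Finset.prod_pos fun e _ => hpos e k)

theorem cavityWeight_pos (hpos : ∀ e k, 0 < m e k) (e : M.Edge)
    (x : {j // j ∈ M.scope e.1.1} → Fin q) : 0 < M.cavityWeight m e x :=
  mul_pos (M.ψ_pos _ x) (Finset.prod_pos fun _ _ => M.varMessage_pos hpos _ _ _)

theorem theta_pos (hpos : ∀ e k, 0 < m e k) (e : M.Edge) (k : Fin q) : 0 < M.theta m e k :=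
  Finset.sum_pos (fun x _ => M.cavityWeight_pos hpos e x) ⟨fun _ => k, by simp⟩

theorem sum_theta_pos (hpos : ∀ e k, 0 < m e k) (hq : 0 < q) (e : M.Edge) :
    0 < ∑ x, M.theta m e x :=
  Finset.sum_pos (fun x _ => M.theta_pos hpos e x) ⟨⟨0, hq⟩, Finset.mem_univ _⟩

theorem varWeight_pos (hpos : ∀ e k, 0 < m e k) (i : V) (k : Fin q) : 0 < M.varWeight m i k :=
  mul_pos (M.φ_pos i k) (Finset.prod_pos fun e _ => hpos e k)

theorem sum_varWeight_pos (hpos : ∀ e k, 0 < m e k) (hq : 0 < q) (i : V) :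
    0 < ∑ x, M.varWeight m i x :=
  Finset.sum_pos (fun x _ => M.varWeight_pos hpos i x) ⟨⟨0, hq⟩, Finset.mem_univ _⟩

theorem varBelief_pos (hpos : ∀ e k, 0 < m e k) (i : V) (k : Fin q) : 0 < M.varBelief m i k :=
  div_pos (M.varWeight_pos hpos i k) (M.sum_varWeight_pos hpos k.pos i)

theorem sum_varBelief (hpos : ∀ e k, 0 < m e k) (hq : 0 < q) (i : V) :
    ∑ k, M.varBelief m i k = 1 := by
  simp only [varBelief]
  rw [← Finset.sum_div, div_self (M.sum_varWeight_pos hpos hq i).ne']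

theorem sum_message (hpos : ∀ e k, 0 < m e k) (hfix : M.bpStep m = m) (hq : 0 < q)
    (e : M.Edge) : ∑ k, m e k = 1 := by
  rw [← hfix]
  simp only [bpStep]
  rw [← Finset.sum_div, div_self (M.sum_theta_pos hpos hq e).ne']

theorem theta_eq_of_fixed (hpos : ∀ e k, 0 < m e k) (hfix : M.bpStep m = m) (e : M.Edge)
    (k : Fin q) : M.theta m e k = m e k * ∑ x, M.theta m e x := by
  have h : M.theta m e k / ∑ x, M.theta m e x = m e k := congrFun (congrFun hfix e) k
  rw [← h, div_mul_cancel₀ _ (M.sum_theta_pos hpos k.pos e).ne']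

theorem factorWeight_eq_mul_cavityWeight (m : M.Messages) (e : M.Edge)
    (x : {j // j ∈ M.scope e.1.1} → Fin q) :
    M.factorWeight m e.1.1 x =
      M.varMessage m e.1.2 e.1.1 (x ⟨e.1.2, e.2⟩) * M.cavityWeight m e x := by
  have h : (Finset.univ.filter fun j : {j // j ∈ M.scope e.1.1} => j.1 ≠ e.1.2) =
      Finset.univ.erase ⟨e.1.2, e.2⟩ := by
    ext j; simp [Subtype.ext_iff]
  rw [factorWeight, cavityWeight, h,
    ← Finset.mul_prod_erase Finset.univ _ (Finset.mem_univ (⟨e.1.2, e.2⟩ : {j // j ∈ _}))]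
  ring

theorem varWeight_eq_varMessage_mul (m : M.Messages) (e : M.Edge) (k : Fin q) :
    M.varWeight m e.1.2 k = M.varMessage m e.1.2 e.1.1 k * m e k := by
  have h : (Finset.univ.filter fun e' : M.Edge => e'.1.2 = e.1.2 ∧ e'.1.1 ≠ e.1.1) =
      (Finset.univ.filter fun e' : M.Edge => e'.1.2 = e.1.2).erase e := by
    ext e'
    simp only [Finset.mem_filter, Finset.mem_univ, true_and, Finset.mem_erase, ne_eq]
    constructor
    · rintro ⟨h1, h2⟩
      exact ⟨fun h => h2 (by rw [h]), h1⟩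
    · rintro ⟨h1, h2⟩
      exact ⟨h2, fun h => h1 (Subtype.ext (Prod.ext h h2))⟩
  rw [varWeight, varMessage, h, ← Finset.mul_prod_erase _ _ (a := e) (by simp)]
  ring

/-- The normalizing constant of `b_a` is that of `b_i` times that of the update on `(a, i)`; this is
where the fixed-point equation enters. -/
theorem sum_factorWeight (hpos : ∀ e k, 0 < m e k) (hfix : M.bpStep m = m) (e : M.Edge) :
    ∑ x, M.factorWeight m e.1.1 x = (∑ k, M.theta m e k) * ∑ k, M.varWeight m e.1.2 k := by
  rw [← Finset.sum_fiberwise Finset.univ (fun x => x ⟨e.1.2, e.2⟩), Finset.mul_sum]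
  refine Finset.sum_congr rfl fun k _ => ?_
  have h : ∀ x ∈ Finset.univ.filter
      (fun x : {j // j ∈ M.scope e.1.1} → Fin q => x ⟨e.1.2, e.2⟩ = k),
      M.factorWeight m e.1.1 x = M.varMessage m e.1.2 e.1.1 k * M.cavityWeight m e x := by
    intro x hx
    rw [factorWeight_eq_mul_cavityWeight, (Finset.mem_filter.1 hx).2]
  rw [Finset.sum_congr rfl h, ← Finset.mul_sum, ← theta_eq_sum_cavityWeight,
    M.theta_eq_of_fixed hpos hfix, varWeight_eq_varMessage_mul]
  ring

/-- The conditional beliefs given `x_i` are the normalized summands of `Θ_{ai,k}`. -/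
theorem factorBelief_div_varBelief (hpos : ∀ e k, 0 < m e k) (hfix : M.bpStep m = m)
    (e : M.Edge) (x : {j // j ∈ M.scope e.1.1} → Fin q) :
    M.factorBelief m e.1.1 x / M.varBelief m e.1.2 (x ⟨e.1.2, e.2⟩) =
      M.cavityWeight m e x / M.theta m e (x ⟨e.1.2, e.2⟩) := by
  set k := x ⟨e.1.2, e.2⟩ with hk
  have h1 := (M.sum_theta_pos hpos k.pos e).ne'
  have h2 := (M.sum_varWeight_pos hpos k.pos e.1.2).ne'
  have h3 := (M.varMessage_pos hpos e.1.2 e.1.1 k).ne'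
  have h4 := (hpos e k).ne'
  rw [factorBelief, varBelief, M.sum_factorWeight hpos hfix, factorWeight_eq_mul_cavityWeight,
    varWeight_eq_varMessage_mul, ← hk, M.theta_eq_of_fixed hpos hfix e k]
  field_simp

theorem condBelief_mul_theta (hpos : ∀ e k, 0 < m e k) (hfix : M.bpStep m = m) (e : M.Edge)
    (j : {j // j ∈ M.scope e.1.1}) (k l : Fin q) :
    M.theta m e k * M.condBelief m e.1.1 ⟨e.1.2, e.2⟩ j k l =
      ∑ x with x ⟨e.1.2, e.2⟩ = k ∧ x j = l, M.cavityWeight m e x := by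
  rw [condBelief, Finset.mul_sum]
  refine Finset.sum_congr rfl fun x hx => ?_
  have hk := (Finset.mem_filter.1 hx).2.1
  have h := M.factorBelief_div_varBelief hpos hfix e x
  dsimp only at h ⊢
  rw [h, hk, mul_div_cancel₀ _ (M.theta_pos hpos e k).ne']

/-- `Θ_{ai,k}` times the conditional expectation of `u(x_j)` given `x_i = k`. -/
theorem sum_condBelief_mul_theta (hpos : ∀ e k, 0 < m e k) (hfix : M.bpStep m = m) (e : M.Edge)
    (j : {j // j ∈ M.scope e.1.1}) (k : Fin q) (u : Fin q → ℝ) :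
    M.theta m e k * (M.condBelief m e.1.1 ⟨e.1.2, e.2⟩ j *ᵥ u) k =
      ∑ x with x ⟨e.1.2, e.2⟩ = k, M.cavityWeight m e x * u (x j) := by
  rw [← Finset.sum_fiberwise _ (fun x => x j), Matrix.mulVec, dotProduct, Finset.mul_sum]
  refine Finset.sum_congr rfl fun l _ => ?_
  rw [← mul_assoc, M.condBelief_mul_theta hpos hfix, Finset.filter_filter, Finset.sum_mul]
  refine Finset.sum_congr rfl fun x hx => ?_
  rw [(Finset.mem_filter.1 hx).2.2]

variable {M}

theorem condBelief_mulVec_const (hpos : ∀ e k, 0 < m e k) (hfix : M.bpStep m = m) (a : F)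
    (i j : {i // i ∈ M.scope a}) (c : ℝ) :
    M.condBelief m a i j *ᵥ (fun _ => c) = fun _ => c := by
  ext k
  have h := M.sum_condBelief_mul_theta hpos hfix ⟨(a, i.1), i.2⟩ j k fun _ => c
  rw [← Finset.sum_mul, ← theta_eq_sum_cavityWeight] at h
  exact mul_left_cancel₀ (M.theta_pos hpos _ k).ne' h

theorem sum_condBelief (hpos : ∀ e k, 0 < m e k) (hfix : M.bpStep m = m) (a : F)
    (i j : {i // i ∈ M.scope a}) (k : Fin q) : ∑ l, M.condBelief m a i j k l = 1 := by
  simpa [Matrix.mulVec, dotProduct] using congrFun (condBelief_mulVec_const hpos hfix a i j 1) k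

theorem condBelief_nonneg (hpos : ∀ e k, 0 < m e k) (a : F)
    (i j : {i // i ∈ M.scope a}) (k l : Fin q) : 0 ≤ M.condBelief m a i j k l := by
  have hw : ∀ x, 0 ≤ M.factorWeight m a x := fun x =>
    mul_nonneg (M.ψ_pos a x).le (Finset.prod_nonneg fun _ _ => (M.varMessage_pos hpos _ _ _).le)
  exact Finset.sum_nonneg fun x _ => div_nonneg
    (div_nonneg (hw x) (Finset.sum_nonneg fun y _ => hw y)) (M.varBelief_pos hpos _ _).le

/-! ### Reversibility and contraction -/

theorem varBelief_mul_condBelief (hpos : ∀ e k, 0 < m e k) (a : F)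
    (i j : {i // i ∈ M.scope a}) (k l : Fin q) :
    M.varBelief m i.1 k * M.condBelief m a i j k l =
      M.varBelief m j.1 l * M.condBelief m a j i l k := by
  have h : ∀ (i j : {i // i ∈ M.scope a}) (k l : Fin q),
      M.varBelief m i.1 k * M.condBelief m a i j k l =
        ∑ x with x i = k ∧ x j = l, M.factorBelief m a x := by
    intro i j k l
    rw [condBelief, Finset.mul_sum]
    refine Finset.sum_congr rfl fun x hx => ?_
    rw [(Finset.mem_filter.1 hx).2.1, mul_div_cancel₀ _ (M.varBelief_pos hpos i.1 k).ne']
  rw [h, h]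
  simp only [and_comm]

/-- `B^{(iaj)}` and `B^{(jai)}` are adjoint to each other between `L²(b_j)` and `L²(b_i)`. -/
theorem sum_varBelief_mul_condBelief_mulVec (hpos : ∀ e k, 0 < m e k) (a : F)
    (i j : {i // i ∈ M.scope a}) (f g : Fin q → ℝ) :
    ∑ k, M.varBelief m i.1 k * (f k * (M.condBelief m a i j *ᵥ g) k) =
      ∑ l, M.varBelief m j.1 l * ((M.condBelief m a j i *ᵥ f) l * g l) := by
  simp only [Matrix.mulVec, dotProduct, Finset.mul_sum, Finset.sum_mul]
  rw [Finset.sum_comm]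
  refine Finset.sum_congr rfl fun l _ => Finset.sum_congr rfl fun k _ => ?_
  have := varBelief_mul_condBelief hpos a i j k l
  linear_combination f k * g l * this

theorem condBelief_mulVec_centered (hpos : ∀ e k, 0 < m e k) (hfix : M.bpStep m = m) (a : F)
    (i j : {i // i ∈ M.scope a}) (g : Fin q → ℝ) :
    ∑ k, M.varBelief m i.1 k * (M.condBelief m a i j *ᵥ g) k =
      ∑ l, M.varBelief m j.1 l * g l := by
  have h := sum_varBelief_mul_condBelief_mulVec hpos a i j (fun _ => 1) g
  simpa [condBelief_mulVec_const hpos hfix] using h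

/-- Conditional expectation is a contraction of `L²`, by Jensen's inequality. -/
theorem sum_varBelief_mul_sq_le (hpos : ∀ e k, 0 < m e k) (hfix : M.bpStep m = m) (a : F)
    (i j : {i // i ∈ M.scope a}) (g : Fin q → ℝ) :
    ∑ k, M.varBelief m i.1 k * (M.condBelief m a i j *ᵥ g) k ^ 2 ≤
      ∑ l, M.varBelief m j.1 l * g l ^ 2 := by
  rw [← condBelief_mulVec_centered hpos hfix a i j fun l => g l ^ 2]
  gcongr with k
  · exact (M.varBelief_pos hpos _ _).le
  have h2 := ((even_two).convexOn_pow (𝕜 := ℝ)).map_sum_le (t := Finset.univ)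
    (w := M.condBelief m a i j k) (p := g) (fun l _ => condBelief_nonneg hpos a i j k l)
    (sum_condBelief hpos hfix a i j k) (fun _ _ => Set.mem_univ _)
  simpa [Matrix.mulVec, dotProduct] using h2

theorem sum_varBelief_mul_combinedKernel (hpos : ∀ e k, 0 < m e k) (a : F)
    (i j : {i // i ∈ M.scope a}) (g : Fin q → ℝ) :
    ∑ k, M.varBelief m i.1 k * (g k * (M.combinedKernel m a i j *ᵥ g) k) =
      ∑ l, M.varBelief m j.1 l * (M.condBelief m a j i *ᵥ g) l ^ 2 := by
  rw [combinedKernel, ← Matrix.mulVec_mulVec, sum_varBelief_mul_condBelief_mulVec hpos]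
  simp only [sq]

theorem sum_varBelief_mul_combinedKernel_le (hpos : ∀ e k, 0 < m e k) (hfix : M.bpStep m = m)
    (a : F) (i j : {i // i ∈ M.scope a}) (g : Fin q → ℝ) :
    ∑ k, M.varBelief m i.1 k * (g k * (M.combinedKernel m a i j *ᵥ g) k) ≤
      ∑ k, M.varBelief m i.1 k * (g k * g k) := by
  rw [sum_varBelief_mul_combinedKernel hpos]
  simpa only [sq] using sum_varBelief_mul_sq_le hpos hfix a j i g

theorem varBelief_mul_combinedKernel (hpos : ∀ e k, 0 < m e k) (a : F)
    (i j : {i // i ∈ M.scope a}) (k l : Fin q) :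
    M.varBelief m i.1 k * M.combinedKernel m a i j k l =
      M.varBelief m i.1 l * M.combinedKernel m a i j l k := by
  simp only [combinedKernel, Matrix.mul_apply, Finset.mul_sum]
  refine Finset.sum_congr rfl fun p _ => ?_
  have h1 := varBelief_mul_condBelief hpos a i j k p
  have h2 := varBelief_mul_condBelief hpos a i j l p
  linear_combination M.condBelief m a j i p l * h1 - M.condBelief m a j i p k * h2

theorem sum_combinedKernel (hpos : ∀ e k, 0 < m e k) (hfix : M.bpStep m = m) (a : F)
    (i j : {i // i ∈ M.scope a}) (k : Fin q) : ∑ l, M.combinedKernel m a i j k l = 1 := by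
  have h : M.combinedKernel m a i j *ᵥ (fun _ => (1 : ℝ)) = fun _ => 1 := by
    rw [combinedKernel, ← Matrix.mulVec_mulVec, condBelief_mulVec_const hpos hfix,
      condBelief_mulVec_const hpos hfix]
  simpa [Matrix.mulVec, dotProduct] using congrFun h k

theorem mu2_nonneg (M : MarkovField V F q) (m : M.Messages) : 0 ≤ M.mu2 m :=
  Real.iSup_nonneg fun _ => Real.sqrt_nonneg _

theorem secondEigenvalue_le_mu2_sq (M : MarkovField V F q) (m : M.Messages) (a : F)
    (i j : {i // i ∈ M.scope a}) (hij : i ≠ j) :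
    secondEigenvalue (M.combinedKernel m a i j) ≤ M.mu2 m ^ 2 := by
  have h : √|secondEigenvalue (M.combinedKernel m a i j)| ≤ M.mu2 m :=
    le_ciSup (f := fun t : M.Triple =>
      √|secondEigenvalue (M.combinedKernel m t.1 t.2.1.1 t.2.1.2)|)
      (Set.finite_range _).bddAbove ⟨a, (i, j), hij⟩
  calc _ ≤ |secondEigenvalue (M.combinedKernel m a i j)| := le_abs_self _
    _ = √|secondEigenvalue (M.combinedKernel m a i j)| ^ 2 := (Real.sq_sqrt (abs_nonneg _)).symm
    _ ≤ _ := by gcongr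

/-- `B^{(iaj)}` contracts the functions of mean zero by the factor `μ₂`. -/
theorem sum_varBelief_mul_sq_le_mu2 (hpos : ∀ e k, 0 < m e k) (hfix : M.bpStep m = m) (a : F)
    (i j : {i // i ∈ M.scope a}) (hij : i ≠ j) {g : Fin q → ℝ}
    (hg : ∑ l, M.varBelief m j.1 l * g l = 0) :
    ∑ k, M.varBelief m i.1 k * (M.condBelief m a i j *ᵥ g) k ^ 2 ≤
      M.mu2 m ^ 2 * ∑ l, M.varBelief m j.1 l * g l ^ 2 := by
  rcases lt_or_ge q 2 with hq | hq
  · have hg0 : g = 0 := by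
      ext k
      have : Subsingleton (Fin q) := Fin.subsingleton_iff_le_one.2 (by omega)
      rw [Fintype.sum_subsingleton _ k] at hg
      exact (mul_eq_zero.1 hg).resolve_left (M.varBelief_pos hpos j.1 k).ne'
    simp [hg0]
  -- `‖B^{(iaj)} g‖²` is the quadratic form of the kernel `K^{(jai)}`, attached to the swapped triple
  · rw [← sum_varBelief_mul_combinedKernel hpos]
    refine (sum_mul_mulVec_le_secondEigenvalue (M.varBelief_pos hpos j.1)
      (varBelief_mul_combinedKernel hpos a j i) (sum_combinedKernel hpos hfix a j i)
      (sum_varBelief_mul_combinedKernel_le hpos hfix a j i) hq hg).trans ?_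
    simp only [← sq]
    gcongr
    · exact Finset.sum_nonneg fun l _ => mul_nonneg (M.varBelief_pos hpos _ _).le (sq_nonneg _)
    · exact secondEigenvalue_le_mu2_sq M m a j i hij.symm

end MarkovField

/-! ### The Jacobian of belief propagation -/

/-- The logarithmic derivative of a product is the sum of the logarithmic derivatives. -/
theorem HasFDerivAt.finset_prod_of_logDeriv {ι X : Type*} [DecidableEq ι] [NormedAddCommGroup X]
    [NormedSpace ℝ X] {s : Finset ι} {f : ι → X → ℝ} {l : ι → X →L[ℝ] ℝ} {x : X}
    (h : ∀ i ∈ s, HasFDerivAt (f i) (f i x • l i) x) :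
    HasFDerivAt (fun y => ∏ i ∈ s, f i y) ((∏ i ∈ s, f i x) • ∑ i ∈ s, l i) x := by
  induction s using Finset.induction_on with
  | empty => simpa using hasFDerivAt_const (1 : ℝ) x
  | insert i s hi ih =>
    simp only [Finset.prod_insert hi, Finset.sum_insert hi]
    refine ((h i (Finset.mem_insert_self i s)).mul
      (ih fun j hj => h j (Finset.mem_insert_of_mem hj))).congr_fderiv ?_
    module

namespace MarkovField

variable {V F : Type*} {q : ℕ} [Fintype V] [DecidableEq V] [Fintype F] [DecidableEq F]
  (M : MarkovField V F q) (m : M.Messages)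

/-- The linear form `v ↦ v_e(k) / m_e(k)`: the derivative at `m` of `log m_e(k)`. -/
def logCoord (e : M.Edge) (k : Fin q) : M.Messages →L[ℝ] ℝ :=
  (m e k)⁻¹ • (ContinuousLinearMap.proj (R := ℝ) k).comp
    (ContinuousLinearMap.proj (R := ℝ) (φ := fun _ : M.Edge => Fin q → ℝ) e)

theorem logCoord_apply (e : M.Edge) (k : Fin q) (v : M.Messages) :
    M.logCoord m e k v = v e k / m e k := by
  simp [logCoord, div_eq_inv_mul]

/-- The matrix `B^{(iaj)}` for `e = (a, i)` and `e' = (a', j)` with `j ∈ a`, and `0` if `j ∉ a`. -/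
def edgeKernel (e e' : M.Edge) : Matrix (Fin q) (Fin q) ℝ :=
  if h : e'.1.2 ∈ M.scope e.1.1 then M.condBelief m e.1.1 ⟨e.1.2, e.2⟩ ⟨e'.1.2, h⟩ else 0

/-- The linearization at `m` of `log Θ` as a function of `log m`:
`(T u)_{ai}(k) = ∑_{a'j} A_{ai}^{a'j} ∑_ℓ b^{(iaj)}_{kℓ} u_{a'j}(ℓ)`. -/
def transfer : M.Messages →ₗ[ℝ] M.Messages where
  toFun u e k := ∑ e', M.lineAdj e e' * (M.edgeKernel m e e' *ᵥ u e') k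
  map_add' u v := by
    ext e k
    simp [Matrix.mulVec_add, mul_add, Finset.sum_add_distrib]
  map_smul' c u := by
    ext e k
    simp only [Pi.smul_apply, Matrix.mulVec_smul, smul_eq_mul, RingHom.id_apply, Finset.mul_sum]
    exact Finset.sum_congr rfl fun _ _ => by ring

theorem transfer_apply (u : M.Messages) (e : M.Edge) (k : Fin q) :
    M.transfer m u e k = ∑ e', M.lineAdj e e' * (M.edgeKernel m e e' *ᵥ u e') k := rfl

/-- The logarithmic coordinates `v / m` of a perturbation `v` of the messages `m`. -/
def toLog : M.Messages →ₗ[ℝ] M.Messages where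
  toFun v e k := v e k / m e k
  map_add' u v := by ext e k; simp [add_div]
  map_smul' c u := by ext e k; simp [mul_div_assoc]

/-- The perturbation of the messages with logarithmic coordinates `u`, after the first-order effect of
the normalization by the sum: `u_e` is replaced by `u_e - ∑ x, m_e(x) u_e(x)`. -/
def ofLog : M.Messages →ₗ[ℝ] M.Messages where
  toFun u e k := m e k * (u e k - ∑ x, m e x * u e x)
  map_add' u v := by
    ext e k
    simp only [Pi.add_apply, mul_add, Finset.sum_add_distrib]
    ring
  map_smul' c u := by
    ext e k
    simp only [Pi.smul_apply, smul_eq_mul, RingHom.id_apply, mul_left_comm _ c, ← Finset.mul_sum]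
    ring

/-- The Jacobian of `bpStep` at a positive fixed point; see `hasFDerivAt_bpStep`. -/
def jacobian : M.Messages →L[ℝ] M.Messages :=
  LinearMap.toContinuousLinearMap (M.ofLog m ∘ₗ M.transfer m ∘ₗ M.toLog m)

variable {M m}

theorem hasFDerivAt_message (hpos : ∀ e k, 0 < m e k) (e : M.Edge) (k : Fin q) :
    HasFDerivAt (fun m' : M.Messages => m' e k) (m e k • M.logCoord m e k) m := by
  rw [logCoord, smul_smul, mul_inv_cancel₀ (hpos e k).ne', one_smul]
  exact ((ContinuousLinearMap.proj (R := ℝ) k).comp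
    (ContinuousLinearMap.proj (R := ℝ) (φ := fun _ : M.Edge => Fin q → ℝ) e)).hasFDerivAt

theorem hasFDerivAt_varMessage (hpos : ∀ e k, 0 < m e k) (j : V) (a : F) (k : Fin q) :
    HasFDerivAt (fun m' => M.varMessage m' j a k) (M.varMessage m j a k •
      ∑ e : M.Edge with e.1.2 = j ∧ e.1.1 ≠ a, M.logCoord m e k) m := by
  refine ((HasFDerivAt.finset_prod_of_logDeriv fun e _ =>
    hasFDerivAt_message hpos e k).const_mul (M.φ j k)).congr_fderiv ?_
  rw [smul_smul, varMessage]

theorem hasFDerivAt_cavityWeight (hpos : ∀ e k, 0 < m e k) (e : M.Edge)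
    (x : {j // j ∈ M.scope e.1.1} → Fin q) :
    HasFDerivAt (fun m' => M.cavityWeight m' e x) (M.cavityWeight m e x •
      ∑ j : {j // j ∈ M.scope e.1.1} with j.1 ≠ e.1.2,
        ∑ e' : M.Edge with e'.1.2 = j.1 ∧ e'.1.1 ≠ e.1.1, M.logCoord m e' (x j)) m := by
  refine ((HasFDerivAt.finset_prod_of_logDeriv fun j _ =>
    hasFDerivAt_varMessage hpos j.1 e.1.1 (x j)).const_mul (M.ψ e.1.1 x)).congr_fderiv ?_
  rw [smul_smul, cavityWeight]

/-- The edges `(a', j)` whose message enters the update on `(a, i)` are those linked to `(a, i)` in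
the oriented line graph. -/
theorem sum_cavity_neighbors (e : M.Edge) (G : {j // j ∈ M.scope e.1.1} → M.Edge → ℝ) :
    ∑ j : {j // j ∈ M.scope e.1.1} with j.1 ≠ e.1.2,
        ∑ e' : M.Edge with e'.1.2 = j.1 ∧ e'.1.1 ≠ e.1.1, G j e' =
      ∑ e' : M.Edge, M.lineAdj e e' *
        if h : e'.1.2 ∈ M.scope e.1.1 then G ⟨e'.1.2, h⟩ e' else 0 := by
  simp only [Finset.sum_filter]
  simp only [← Finset.sum_filter (fun j : {j // j ∈ M.scope e.1.1} => j.1 ≠ e.1.2)]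
  rw [Finset.sum_comm]
  refine Finset.sum_congr rfl fun e' _ => ?_
  rw [Finset.sum_filter]
  by_cases h : e'.1.2 ∈ M.scope e.1.1
  · rw [Finset.sum_eq_single ⟨e'.1.2, h⟩, dif_pos h]
    · simp only [lineAdj, Finset.mem_inter, h, e'.2]
      by_cases h1 : e'.1.2 = e.1.2 <;> by_cases h2 : e'.1.1 = e.1.1 <;> simp [h1, h2]
    · intro j _ hj
      have : e'.1.2 ≠ j.1 := fun h' => hj (Subtype.ext h'.symm)
      simp [this]
    · simp
  · rw [dif_neg h, mul_zero]
    refine Finset.sum_eq_zero fun j _ => ?_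
    have : e'.1.2 ≠ j.1 := fun h' => h (h' ▸ j.2)
    simp [this]

theorem hasFDerivAt_theta (hpos : ∀ e k, 0 < m e k) (hfix : M.bpStep m = m) (e : M.Edge)
    (k : Fin q) :
    ∃ D : M.Messages →L[ℝ] ℝ, HasFDerivAt (fun m' => M.theta m' e k) D m ∧
      ∀ v, D v = M.theta m e k * M.transfer m (M.toLog m v) e k := by
  refine ⟨_, HasFDerivAt.fun_sum fun x _ => hasFDerivAt_cavityWeight hpos e x, fun v => ?_⟩
  simp only [sum_apply, smul_apply, smul_eq_mul,
    logCoord_apply]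
  have h1 : ∀ x : {j // j ∈ M.scope e.1.1} → Fin q,
      ∑ j : {j // j ∈ M.scope e.1.1} with j.1 ≠ e.1.2,
        ∑ e' : M.Edge with e'.1.2 = j.1 ∧ e'.1.1 ≠ e.1.1, v e' (x j) / m e' (x j) =
      ∑ e' : M.Edge, M.lineAdj e e' *
        if h : e'.1.2 ∈ M.scope e.1.1 then M.toLog m v e' (x ⟨e'.1.2, h⟩) else 0 :=
    fun x => sum_cavity_neighbors e fun j e' => v e' (x j) / m e' (x j)
  simp only [h1, Finset.mul_sum, transfer_apply]
  rw [Finset.sum_comm]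
  refine Finset.sum_congr rfl fun e' _ => ?_
  rw [edgeKernel]
  split_ifs with h
  · rw [mul_left_comm, M.sum_condBelief_mul_theta hpos hfix, Finset.mul_sum]
    exact Finset.sum_congr rfl fun x _ => by ring
  · simp

theorem hasFDerivAt_bpStep (hpos : ∀ e k, 0 < m e k) (hfix : M.bpStep m = m) :
    HasFDerivAt M.bpStep (M.jacobian m) m := by
  rw [hasFDerivAt_pi']
  intro e
  rw [hasFDerivAt_pi']
  intro k
  choose D hD hDv using hasFDerivAt_theta hpos hfix e
  have hS := M.sum_theta_pos hpos k.pos e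
  have hinv := (hasDerivAt_inv hS.ne').comp_hasFDerivAt m
    (HasFDerivAt.fun_sum fun x (_ : x ∈ Finset.univ) => hD x)
  refine ((hD k).mul hinv).congr_fderiv ?_
  ext v
  have hsum : ∑ x, M.theta m e x * M.transfer m (M.toLog m v) e x =
      (∑ x, M.theta m e x) * ∑ x, m e x * M.transfer m (M.toLog m v) e x := by
    rw [Finset.mul_sum]
    refine Finset.sum_congr rfl fun x _ => ?_
    rw [M.theta_eq_of_fixed hpos hfix e x]
    ring
  have hR : M.jacobian m v e k = m e k * (M.transfer m (M.toLog m v) e k -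
      ∑ x, m e x * M.transfer m (M.toLog m v) e x) := rfl
  simp only [sum_apply, smul_apply,
    add_apply, smul_eq_mul, ContinuousLinearMap.comp_apply,
    ContinuousLinearMap.proj_apply, Function.comp_apply, hDv, hsum, hR, M.theta_eq_of_fixed hpos hfix e k]
  field_simp
  ring

theorem analyticAt_bpStep (hpos : ∀ e k, 0 < m e k) : AnalyticAt ℝ M.bpStep m := by
  have hmsg : ∀ e k, AnalyticAt ℝ (fun m' : M.Messages => m' e k) m := fun e k =>
    ((ContinuousLinearMap.proj (R := ℝ) k).comp
      (ContinuousLinearMap.proj (R := ℝ) (φ := fun _ : M.Edge => Fin q → ℝ) e)).analyticAt m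
  have hvar : ∀ j a k, AnalyticAt ℝ (fun m' => M.varMessage m' j a k) m := fun j a k =>
    analyticAt_const.mul (Finset.analyticAt_fun_prod _ fun e _ => hmsg e k)
  have htheta : ∀ e k, AnalyticAt ℝ (fun m' => M.theta m' e k) m := fun e k =>
    Finset.analyticAt_fun_sum _ fun x _ =>
      analyticAt_const.mul (Finset.analyticAt_fun_prod _ fun j _ => hvar _ _ _)
  rw [analyticAt_pi_iff]
  intro e
  rw [analyticAt_pi_iff]
  intro k
  exact (htheta e k).div (Finset.analyticAt_fun_sum _ fun x _ => htheta e x)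
    (M.sum_theta_pos hpos k.pos e).ne'

theorem lineAdj_nonneg (e e' : M.Edge) : 0 ≤ M.lineAdj e e' := by
  rw [lineAdj]; split_ifs <;> norm_num

theorem lineAdj_eq_zero_or (e e' : M.Edge) : M.lineAdj e e' = 0 ∨
    ∃ h : e'.1.2 ∈ M.scope e.1.1, e'.1.2 ≠ e.1.2 ∧
      M.edgeKernel m e e' = M.condBelief m e.1.1 ⟨e.1.2, e.2⟩ ⟨e'.1.2, h⟩ := by
  rw [lineAdj]
  split_ifs with h
  · have h' := (Finset.mem_inter.1 h.1).1
    exact Or.inr ⟨h', h.2.1, dif_pos h'⟩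
  · exact Or.inl rfl

/-! ### Constant perturbations and the powers of the Jacobian -/

theorem transfer_const (hpos : ∀ e k, 0 < m e k) (hfix : M.bpStep m = m) (c : M.Edge → ℝ) :
    M.transfer m (fun e _ => c e) = fun e _ => (M.lineAdj *ᵥ c) e := by
  ext e k
  rw [transfer_apply, Matrix.mulVec, dotProduct]
  refine Finset.sum_congr rfl fun e' _ => ?_
  rcases lineAdj_eq_zero_or (m := m) e e' with h | ⟨h, -, hk⟩
  · rw [h]; simp
  · rw [hk, condBelief_mulVec_const hpos hfix]

theorem ofLog_const (hpos : ∀ e k, 0 < m e k) (hfix : M.bpStep m = m) (c : M.Edge → ℝ) :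
    M.ofLog m (fun e _ => c e) = 0 := by
  ext e k
  show m e k * (c e - ∑ x, m e x * c e) = 0
  rw [← Finset.sum_mul, M.sum_message hpos hfix k.pos, one_mul, sub_self, mul_zero]

theorem transfer_pow_const (hpos : ∀ e k, 0 < m e k) (hfix : M.bpStep m = m) (c : M.Edge → ℝ)
    (n : ℕ) : ∃ c' : M.Edge → ℝ, (M.transfer m ^ n) (fun e _ => c e) = fun e _ => c' e := by
  induction n with
  | zero => exact ⟨c, rfl⟩
  | succ n ih =>
    obtain ⟨c', hc'⟩ := ih
    exact ⟨_, by rw [pow_succ', Module.End.mul_apply, hc', transfer_const hpos hfix]⟩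

/-- Perturbations that are constant on every edge only rescale the messages and are erased by the
normalization, even after some unnormalized steps. -/
theorem ofLog_transfer_pow_sub_const (hpos : ∀ e k, 0 < m e k) (hfix : M.bpStep m = m)
    (n : ℕ) (u : M.Messages) (c : M.Edge → ℝ) :
    M.ofLog m ((M.transfer m ^ n) (u - fun e _ => c e)) =
      M.ofLog m ((M.transfer m ^ n) u) := by
  obtain ⟨c', hc'⟩ := transfer_pow_const hpos hfix c n
  rw [map_sub, map_sub, hc', ofLog_const hpos hfix, sub_zero]

theorem toLog_ofLog (hpos : ∀ e k, 0 < m e k) (u : M.Messages) :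
    M.toLog m (M.ofLog m u) = u - fun e _ => ∑ x, m e x * u e x := by
  ext e k
  exact mul_div_cancel_left₀ _ (hpos e k).ne'

theorem jacobian_apply (v : M.Messages) :
    M.jacobian m v = M.ofLog m (M.transfer m (M.toLog m v)) := rfl

theorem jacobian_pow_ofLog (hpos : ∀ e k, 0 < m e k) (hfix : M.bpStep m = m) (n : ℕ)
    (u : M.Messages) :
    (M.jacobian m ^ n) (M.ofLog m u) = M.ofLog m ((M.transfer m ^ n) u) := by
  induction n generalizing u with
  | zero => rfl
  | succ n ih =>
    have h1 : (M.jacobian m ^ (n + 1)) (M.ofLog m u) =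
      (M.jacobian m ^ n) (M.jacobian m (M.ofLog m u)) := by rw [pow_succ]; rfl
    have h2 : ∀ x, (M.transfer m ^ n) (M.transfer m x) = (M.transfer m ^ (n + 1)) x := fun x => by
      rw [pow_succ, Module.End.mul_apply]
    rw [h1, jacobian_apply, ih, toLog_ofLog hpos, h2,
      ofLog_transfer_pow_sub_const hpos hfix (n + 1)]

theorem jacobian_pow_succ (hpos : ∀ e k, 0 < m e k) (hfix : M.bpStep m = m) (n : ℕ)
    (v : M.Messages) :
    (M.jacobian m ^ (n + 1)) v = M.ofLog m ((M.transfer m ^ (n + 1)) (M.toLog m v)) := by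
  have h1 : (M.jacobian m ^ (n + 1)) v = (M.jacobian m ^ n) (M.jacobian m v) := by
    rw [pow_succ]; rfl
  rw [h1, jacobian_apply, jacobian_pow_ofLog hpos hfix, pow_succ, Module.End.mul_apply]

end MarkovField

/-! ### Weighted `L²` norms -/

/-- The norm `(∑ k, b k * g k ^ 2) ^ (1 / 2)` of `L²(b)`, written as the Euclidean norm of `√b * g`. -/
def weightedNorm {q : ℕ} (b g : Fin q → ℝ) : ℝ :=
  ‖(WithLp.toLp 2 fun k => √(b k) * g k : EuclideanSpace ℝ (Fin q))‖

section weightedNorm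

variable {q : ℕ} {b : Fin q → ℝ}

theorem weightedNorm_nonneg (g : Fin q → ℝ) : 0 ≤ weightedNorm b g := norm_nonneg _

theorem weightedNorm_sq (hb : ∀ k, 0 < b k) (g : Fin q → ℝ) :
    weightedNorm b g ^ 2 = ∑ k, b k * g k ^ 2 := by
  rw [weightedNorm, EuclideanSpace.norm_sq_eq]
  refine Finset.sum_congr rfl fun k _ => ?_
  rw [Real.norm_eq_abs, sq_abs, mul_pow, Real.sq_sqrt (hb k).le]

theorem weightedNorm_sum_le {ι : Type*} (s : Finset ι) (c : ι → ℝ) (hc : ∀ i, 0 ≤ c i)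
    (g : ι → Fin q → ℝ) :
    weightedNorm b (fun k => ∑ i ∈ s, c i * g i k) ≤ ∑ i ∈ s, c i * weightedNorm b (g i) := by
  have h : (WithLp.toLp 2 fun k => √(b k) * ∑ i ∈ s, c i * g i k : EuclideanSpace ℝ (Fin q)) =
      ∑ i ∈ s, c i • WithLp.toLp 2 fun k => √(b k) * g i k := by
    ext k
    simp only [Finset.mul_sum, WithLp.ofLp_sum, WithLp.ofLp_smul, Finset.sum_apply, Pi.smul_apply,
      smul_eq_mul]
    exact Finset.sum_congr rfl fun i _ => by ring
  rw [weightedNorm, h]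
  refine (norm_sum_le _ _).trans (Finset.sum_le_sum fun i _ => ?_)
  rw [norm_smul, Real.norm_of_nonneg (hc i), weightedNorm]

theorem abs_le_weightedNorm (hb : ∀ k, 0 < b k) (g : Fin q → ℝ) (k : Fin q) :
    |g k| ≤ (√(b k))⁻¹ * weightedNorm b g := by
  have h := PiLp.norm_apply_le (WithLp.toLp 2 fun k => √(b k) * g k : EuclideanSpace ℝ (Fin q)) k
  have hk := Real.sqrt_pos.2 (hb k)
  rw [inv_mul_eq_div, le_div_iff₀' hk, weightedNorm]
  simpa [abs_mul, abs_of_pos hk] using h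

theorem weightedNorm_le_norm (hb : ∀ k, 0 < b k) (hb1 : ∑ k, b k = 1) (g : Fin q → ℝ) :
    weightedNorm b g ≤ ‖g‖ := by
  refine (sq_le_sq₀ (weightedNorm_nonneg g) (norm_nonneg g)).1 ?_
  rw [weightedNorm_sq hb, ← one_mul (‖g‖ ^ 2), ← hb1, Finset.sum_mul]
  refine Finset.sum_le_sum fun k _ => ?_
  have := norm_le_pi_norm g k
  rw [← sq_abs (g k), ← Real.norm_eq_abs]
  have := (hb k).le
  gcongr

end weightedNorm

namespace MarkovField

variable {V F : Type*} {q : ℕ} [Fintype V] [DecidableEq V] [Fintype F] [DecidableEq F]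
  {M : MarkovField V F q} {m : M.Messages}

/-! ### Norm bound on the powers of the Jacobian -/

/-- On every edge `(a, i)`, the family `u` has mean zero with respect to the belief `b_i`. -/
def Centered (M : MarkovField V F q) (m u : M.Messages) : Prop :=
  ∀ e : M.Edge, ∑ k, M.varBelief m e.1.2 k * u e k = 0

/-- The family, indexed by the edges `(a, i)`, of the norms of `u_{ai}` in `L²(b_i)`. -/
def edgeNorm (M : MarkovField V F q) (m u : M.Messages) (e : M.Edge) : ℝ :=
  weightedNorm (M.varBelief m e.1.2) (u e)

theorem edgeNorm_nonneg (u : M.Messages) (e : M.Edge) : 0 ≤ M.edgeNorm m u e :=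
  weightedNorm_nonneg _

theorem Centered.transfer (hpos : ∀ e k, 0 < m e k) (hfix : M.bpStep m = m) {u : M.Messages}
    (hu : M.Centered m u) : M.Centered m (M.transfer m u) := by
  intro e
  simp only [transfer_apply, Finset.mul_sum]
  rw [Finset.sum_comm]
  refine Finset.sum_eq_zero fun e' _ => ?_
  rcases lineAdj_eq_zero_or (m := m) e e' with h | ⟨h, -, hk⟩
  · simp [h]
  · have h1 := condBelief_mulVec_centered hpos hfix e.1.1 ⟨e.1.2, e.2⟩ ⟨e'.1.2, h⟩ (u e')
    rw [hu e'] at h1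
    rw [hk]
    simp only [mul_left_comm _ (M.lineAdj e e'), ← Finset.mul_sum]
    rw [h1, mul_zero]

theorem edgeNorm_transfer_le (hpos : ∀ e k, 0 < m e k) (hfix : M.bpStep m = m) {u : M.Messages}
    (hu : M.Centered m u) (e : M.Edge) :
    M.edgeNorm m (M.transfer m u) e ≤ M.mu2 m * (M.lineAdj *ᵥ M.edgeNorm m u) e := by
  rw [Matrix.mulVec, dotProduct, Finset.mul_sum]
  refine (weightedNorm_sum_le Finset.univ (M.lineAdj e) (lineAdj_nonneg e)
    fun e' => M.edgeKernel m e e' *ᵥ u e').trans (Finset.sum_le_sum fun e' _ => ?_)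
  rcases lineAdj_eq_zero_or (m := m) e e' with h | ⟨h, hne, hk⟩
  · simp [h]
  · rw [mul_left_comm]
    refine mul_le_mul_of_nonneg_left ?_ (lineAdj_nonneg e e')
    refine (sq_le_sq₀ (weightedNorm_nonneg _)
      (mul_nonneg (mu2_nonneg M m) (weightedNorm_nonneg _))).1 ?_
    rw [mul_pow, weightedNorm_sq (M.varBelief_pos hpos _),
      weightedNorm_sq (M.varBelief_pos hpos _), hk]
    exact sum_varBelief_mul_sq_le_mu2 hpos hfix e.1.1 ⟨e.1.2, e.2⟩ ⟨e'.1.2, h⟩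
      (fun h' => hne (congrArg Subtype.val h').symm) (hu e')

theorem edgeNorm_transfer_pow_le (hpos : ∀ e k, 0 < m e k) (hfix : M.bpStep m = m)
    {u : M.Messages} (hu : M.Centered m u) (n : ℕ) :
    M.Centered m ((M.transfer m ^ n) u) ∧ ∀ e, M.edgeNorm m ((M.transfer m ^ n) u) e ≤
      M.mu2 m ^ n * (M.lineAdj ^ n *ᵥ M.edgeNorm m u) e := by
  induction n with
  | zero => exact ⟨hu, fun e => by simp⟩
  | succ n ih =>
    rw [pow_succ', Module.End.mul_apply]
    refine ⟨ih.1.transfer hpos hfix, fun e => (edgeNorm_transfer_le hpos hfix ih.1 e).trans ?_⟩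
    rw [pow_succ', pow_succ', mul_assoc, ← Matrix.mulVec_mulVec]
    refine mul_le_mul_of_nonneg_left ?_ (mu2_nonneg M m)
    have hA : ∀ w, (M.lineAdj *ᵥ w) e = ∑ e', M.lineAdj e e' * w e' := fun _ => rfl
    rw [hA, hA, Finset.mul_sum]
    refine Finset.sum_le_sum fun e' _ => ?_
    rw [mul_left_comm]
    exact mul_le_mul_of_nonneg_left (ih.2 e') (lineAdj_nonneg e e')

theorem exists_norm_jacobian_pow_le (hpos : ∀ e k, 0 < m e k) (hfix : M.bpStep m = m)
    (hq : 0 < q) {ρ : ℝ} (hρ : M.lambda1 < ρ) :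
    ∃ C, ∀ n, ‖M.jacobian m ^ n‖ ≤ C * (ρ * M.mu2 m) ^ n := by
  obtain ⟨C, hC, hCn⟩ := exists_norm_pow_mulVec_le M.lineAdj hρ
  have hμ := mu2_nonneg M m
  have hρ0 : 0 ≤ ρ := (perronEigenvalue_nonneg M.lineAdj).trans hρ.le
  have hb := fun e : M.Edge => M.varBelief_pos hpos e.1.2
  -- centering, with respect to the beliefs, of the logarithmic coordinates
  let Q : M.Messages →ₗ[ℝ] M.Messages :=
    { toFun := fun v => M.toLog m v - fun e _ => ∑ x, M.varBelief m e.1.2 x * M.toLog m v e x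
      map_add' := fun u v => by
        ext e k
        simp only [map_add, Pi.sub_apply, Pi.add_apply, mul_add, Finset.sum_add_distrib]
        ring
      map_smul' := fun c u => by
        ext e k
        simp only [map_smul, Pi.sub_apply, Pi.smul_apply, smul_eq_mul, RingHom.id_apply,
          mul_left_comm _ c, ← Finset.mul_sum]
        ring }
  have hQ : ∀ v, M.Centered m (Q v) := fun v e => by
    show ∑ k, M.varBelief m e.1.2 k *
      (M.toLog m v e k - ∑ x, M.varBelief m e.1.2 x * M.toLog m v e x) = 0
    simp only [mul_sub, Finset.sum_sub_distrib, ← Finset.sum_mul]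
    rw [M.sum_varBelief hpos hq, one_mul, sub_self]
  let Qc := LinearMap.toContinuousLinearMap Q
  let R := LinearMap.toContinuousLinearMap (M.ofLog m)
  set W := ∑ e : M.Edge, ∑ k, (√(M.varBelief m e.1.2 k))⁻¹ with hW
  have hW0 : 0 ≤ W := Finset.sum_nonneg fun _ _ => Finset.sum_nonneg fun _ _ => by positivity
  have hnorm : ∀ u : M.Messages, ‖u‖ ≤ W * ‖M.edgeNorm m u‖ := by
    intro u
    refine (pi_norm_le_iff_of_nonneg (by positivity)).2 fun e =>
      (pi_norm_le_iff_of_nonneg (by positivity)).2 fun k => ?_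
    refine (abs_le_weightedNorm (hb e) (u e) k).trans ?_
    refine mul_le_mul ?_ ((le_abs_self _).trans (norm_le_pi_norm (M.edgeNorm m u) e))
      (weightedNorm_nonneg _) hW0
    refine le_trans ?_ (Finset.single_le_sum (f := fun e : M.Edge =>
      ∑ k, (√(M.varBelief m e.1.2 k))⁻¹) (fun _ _ => Finset.sum_nonneg fun _ _ => by positivity)
      (Finset.mem_univ e))
    exact Finset.single_le_sum (f := fun k => (√(M.varBelief m e.1.2 k))⁻¹)
      (fun _ _ => by positivity) (Finset.mem_univ k)
  have hedge : ∀ u : M.Messages, ‖M.edgeNorm m u‖ ≤ ‖u‖ := fun u =>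
    (pi_norm_le_iff_of_nonneg (norm_nonneg u)).2 fun e => by
      rw [Real.norm_of_nonneg (edgeNorm_nonneg _ e)]
      exact (weightedNorm_le_norm (hb e) (M.sum_varBelief hpos hq _) _).trans
        (norm_le_pi_norm u e)
  have hbound : ∀ n v, ‖(M.jacobian m ^ (n + 1)) v‖ ≤
      (‖R‖ * W * C * ‖Qc‖) * (ρ * M.mu2 m) ^ (n + 1) * ‖v‖ := by
    intro n v
    have h1 : (M.jacobian m ^ (n + 1)) v = R ((M.transfer m ^ (n + 1)) (Q v)) := by
      rw [jacobian_pow_succ hpos hfix]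
      exact (ofLog_transfer_pow_sub_const hpos hfix (n + 1) _ _).symm
    have h2 : ‖M.edgeNorm m ((M.transfer m ^ (n + 1)) (Q v))‖ ≤
        M.mu2 m ^ (n + 1) * ‖M.lineAdj ^ (n + 1) *ᵥ M.edgeNorm m (Q v)‖ := by
      refine (pi_norm_le_iff_of_nonneg (by positivity)).2 fun e => ?_
      rw [Real.norm_of_nonneg (edgeNorm_nonneg _ e)]
      refine ((edgeNorm_transfer_pow_le hpos hfix (hQ v) (n + 1)).2 e).trans ?_
      gcongr
      exact (le_abs_self _).trans (norm_le_pi_norm (M.lineAdj ^ (n + 1) *ᵥ M.edgeNorm m (Q v)) e)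
    calc ‖(M.jacobian m ^ (n + 1)) v‖ ≤ ‖R‖ * ‖(M.transfer m ^ (n + 1)) (Q v)‖ := by
          rw [h1]; exact R.le_opNorm _
      _ ≤ ‖R‖ * (W * (M.mu2 m ^ (n + 1) * (C * ρ ^ (n + 1) * (‖Qc‖ * ‖v‖)))) := by
          gcongr
          refine (hnorm _).trans ?_
          gcongr
          refine h2.trans ?_
          gcongr
          refine (hCn _ _).trans ?_
          gcongr
          exact (hedge _).trans (Qc.le_opNorm v)
      _ = _ := by rw [mul_pow]; ring
  refine ⟨max 1 (‖R‖ * W * C * ‖Qc‖), fun n => ?_⟩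
  have hs : 0 ≤ ρ * M.mu2 m := mul_nonneg hρ0 hμ
  cases n with
  | zero =>
    rw [pow_zero, pow_zero, mul_one]
    exact ContinuousLinearMap.norm_id_le.trans (le_max_left _ _)
  | succ n =>
    refine ContinuousLinearMap.opNorm_le_bound _ (by positivity) fun v => (hbound n v).trans ?_
    gcongr
    exact le_max_right _ _

/-! ### Stability when `λ₁ μ₂ < 1` -/

theorem stable_of_lambda1_mul_mu2_lt_one (hpos : ∀ e k, 0 < m e k) (hfix : M.bpStep m = m)
    (h : M.lambda1 * M.mu2 m < 1) :
    LyapunovStable M.bpStep m ∧ LocallyAttractive M.bpStep m := by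
  rcases Nat.eq_zero_or_pos q with rfl | hq
  · have hsub : Subsingleton M.Messages := inferInstance
    refine ⟨⟨hfix, fun U hU => Eventually.of_forall fun y n => ?_⟩,
      Eventually.of_forall fun y => ?_⟩
    · rw [Subsingleton.elim (M.bpStep^[n] y) m]
      exact mem_of_mem_nhds hU
    · simp only [fun n => Subsingleton.elim (M.bpStep^[n] y) m]
      exact tendsto_const_nhds
  have hl : 0 ≤ M.lambda1 := perronEigenvalue_nonneg M.lineAdj
  have hμ := mu2_nonneg M m
  obtain ⟨ρ, hρ, hρ1⟩ : ∃ ρ, M.lambda1 < ρ ∧ ρ * M.mu2 m < 1 := by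
    have hev : ∀ᶠ ρ in 𝓝[>] M.lambda1, ρ * M.mu2 m < 1 :=
      (((continuous_id.mul continuous_const).tendsto M.lambda1).mono_left
        nhdsWithin_le_nhds).eventually_lt_const h
    exact (eventually_mem_nhdsWithin.and hev).exists
  have hs : 0 ≤ ρ * M.mu2 m := mul_nonneg (hl.trans hρ.le) hμ
  obtain ⟨C, hC⟩ := exists_norm_jacobian_pow_le hpos hfix hq hρ
  have hlim : Tendsto (fun n : ℕ => C * (ρ * M.mu2 m) ^ n) atTop (𝓝 0) := by
    simpa using (tendsto_pow_atTop_nhds_zero_of_lt_one hs hρ1).const_mul C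
  obtain ⟨N, hN, hN0⟩ := ((hlim.eventually_lt_const one_pos).and (eventually_gt_atTop 0)).exists
  exact stable_of_norm_pow_lt_one (hasFDerivAt_bpStep hpos hfix) hfix hN0 ((hC N).trans_lt hN)

/-! ### Instability of homogeneous fixed points when `1 < λ₁ μ₂` -/

/-- In the homogeneous case `K = B²`, and its second eigenvalue is the square of an eigenvalue of `B`
that has a nonconstant eigenvector. The condition `μ₂ ≠ 0` excludes the case where there is no triple
`(i, a, j)` and the case `q ≤ 1`. -/
theorem Homogeneous.exists_eigenvector (hpos : ∀ e k, 0 < m e k) (hfix : M.bpStep m = m)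
    {B : Matrix (Fin q) (Fin q) ℝ}
    (hB : ∀ (a : F) (i j : {i // i ∈ M.scope a}), i ≠ j → M.condBelief m a i j = B)
    (hμ : M.mu2 m ≠ 0) :
    0 < q ∧ ∃ (ν : ℝ) (v : Fin q → ℝ), |ν| = M.mu2 m ∧ B *ᵥ v = ν • v ∧
      ∀ c : ℝ, v ≠ fun _ => c := by
  obtain ⟨⟨a, ⟨i, j⟩, hij⟩⟩ : Nonempty M.Triple := by
    by_contra h
    rw [not_nonempty_iff] at h
    exact hμ (Real.iSup_of_isEmpty _)
  have hK : ∀ t : M.Triple, M.combinedKernel m t.1 t.2.1.1 t.2.1.2 = B * B := fun t => by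
    rw [combinedKernel, hB _ _ _ t.2.2, hB _ _ _ t.2.2.symm]
  have hij' : i ≠ j := hij
  have hKij : M.combinedKernel m a i j = B * B := hK ⟨a, (i, j), hij⟩
  have hmu : M.mu2 m = √|secondEigenvalue (B * B)| := by
    have : Nonempty M.Triple := ⟨⟨a, (i, j), hij⟩⟩
    rw [mu2]
    simp only [hK, ciSup_const]
  have hq : 2 ≤ q := by
    by_contra hq
    refine hμ ?_
    rw [hmu, secondEigenvalue, List.getD_eq_default, abs_zero, Real.sqrt_zero]
    rw [Multiset.length_sort]
    refine (Polynomial.card_roots' _).trans ?_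
    rw [Matrix.charpoly_natDegree_eq_dim, Fintype.card_fin]
    omega
  refine ⟨by omega, ?_⟩
  have hb := M.varBelief_pos hpos i.1
  obtain ⟨v, hv, hvc⟩ := exists_nonconstant_eigenvector_secondEigenvalue hb
    (varBelief_mul_combinedKernel hpos a i j) (sum_combinedKernel hpos hfix a i j)
    (sum_varBelief_mul_combinedKernel_le hpos hfix a i j) hq
  have hnn : 0 ≤ secondEigenvalue (M.combinedKernel m a i j) := by
    have h1 := sum_varBelief_mul_combinedKernel hpos a i j v
    rw [hv] at h1
    have h2 : ∑ k, M.varBelief m i.1 k *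
        (v k * (secondEigenvalue (M.combinedKernel m a i j) • v) k) =
        secondEigenvalue (M.combinedKernel m a i j) * ∑ k, M.varBelief m i.1 k * v k ^ 2 := by
      rw [Finset.mul_sum]
      refine Finset.sum_congr rfl fun k _ => ?_
      rw [Pi.smul_apply, smul_eq_mul]
      ring
    rw [h2] at h1
    obtain ⟨k, hk⟩ := Function.ne_iff.1 (hvc 0)
    have h3 : 0 < ∑ k, M.varBelief m i.1 k * v k ^ 2 :=
      Finset.sum_pos' (fun k _ => mul_nonneg (hb k).le (sq_nonneg _))
        ⟨k, Finset.mem_univ k, mul_pos (hb k) (sq_pos_of_ne_zero hk)⟩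
    refine nonneg_of_mul_nonneg_left (h1.symm ▸ ?_) h3
    exact Finset.sum_nonneg fun l _ =>
      mul_nonneg (M.varBelief_pos hpos j.1 l).le (sq_nonneg _)
  rw [hKij] at hv hnn
  rw [hmu, abs_of_nonneg hnn]
  refine exists_nonconstant_eigenvector_of_sq ?_ (Real.sqrt_nonneg _) ?_ hvc
  · rw [← hB a i j hij']
    exact sum_condBelief hpos hfix a i j
  · rw [hv, Real.mul_self_sqrt hnn]

/-- The perturbation of the messages whose logarithmic coordinates are `w_e v(k)`, projected so that
the normalization of the messages is preserved. -/
def mode (M : MarkovField V F q) (m : M.Messages) (v : Fin q → ℝ) :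
    (M.Edge → ℝ) →ₗ[ℝ] M.Messages where
  toFun w := M.ofLog m fun e k => w e * v k
  map_add' w w' := by
    rw [← map_add]
    congr 1
    ext e k
    exact add_mul _ _ _
  map_smul' c w := by
    rw [RingHom.id_apply, ← map_smul]
    congr 1
    ext e k
    exact mul_assoc _ _ _

theorem mode_injective (hpos : ∀ e k, 0 < m e k) {v : Fin q → ℝ} (hv : ∀ c : ℝ, v ≠ fun _ => c) :
    Function.Injective (M.mode m v) := by
  rw [← LinearMap.ker_eq_bot, LinearMap.ker_eq_bot']
  intro w hw
  ext e
  by_contra hwe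
  refine hv (∑ x, m e x * v x) (funext fun k => ?_)
  have h : m e k * (w e * v k - ∑ x, m e x * (w e * v x)) = 0 := congrFun (congrFun hw e) k
  have h1 := (mul_eq_zero.1 h).resolve_left (hpos e k).ne'
  simp only [mul_left_comm _ (w e), ← Finset.mul_sum, ← mul_sub] at h1
  exact sub_eq_zero.1 ((mul_eq_zero.1 h1).resolve_left hwe)

theorem transfer_pow_tensor {B : Matrix (Fin q) (Fin q) ℝ}
    (hB : ∀ (a : F) (i j : {i // i ∈ M.scope a}), i ≠ j → M.condBelief m a i j = B)
    {ν : ℝ} {v : Fin q → ℝ} (hv : B *ᵥ v = ν • v) (n : ℕ) (w : M.Edge → ℝ) :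
    (M.transfer m ^ n) (fun e k => w e * v k) =
      fun e k => (ν ^ n • (M.lineAdj ^ n *ᵥ w)) e * v k := by
  induction n generalizing w with
  | zero => simp
  | succ n ih =>
    have h : M.transfer m (fun e k => w e * v k) =
        fun e k => (ν • (M.lineAdj *ᵥ w)) e * v k := by
      ext e k
      rw [transfer_apply, Pi.smul_apply, Matrix.mulVec, dotProduct, smul_eq_mul, Finset.mul_sum,
        Finset.sum_mul]
      refine Finset.sum_congr rfl fun e' _ => ?_
      rcases lineAdj_eq_zero_or (m := m) e e' with h | ⟨h, hne, hk⟩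
      · simp [h]
      · rw [hk, hB _ _ _ fun h' => hne (congrArg Subtype.val h').symm]
        have h1 : (fun k => w e' * v k) = w e' • v := rfl
        rw [h1, Matrix.mulVec_smul, hv]
        simp only [Pi.smul_apply, smul_eq_mul]
        ring
    rw [pow_succ, Module.End.mul_apply, h, ih, Matrix.mulVec_smul, smul_smul, ← pow_succ,
      Matrix.mulVec_mulVec, ← pow_succ]

theorem not_lyapunovStable_of_one_lt (hpos : ∀ e k, 0 < m e k) (hfix : M.bpStep m = m)
    (hhom : M.Homogeneous m) (h : 1 < M.lambda1 * M.mu2 m) : ¬ LyapunovStable M.bpStep m := by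
  obtain ⟨B, hB⟩ := hhom
  have hl : 0 ≤ M.lambda1 := perronEigenvalue_nonneg M.lineAdj
  have hμ0 : M.mu2 m ≠ 0 := fun h0 => by rw [h0, mul_zero] at h; linarith
  have hl0 : M.lambda1 ≠ 0 := fun h0 => by rw [h0, zero_mul] at h; linarith
  have hμ := mu2_nonneg M m
  have hμpos : 0 < M.mu2 m := lt_of_le_of_ne hμ hμ0.symm
  obtain ⟨hq, ν, v, hν, hv, hvc⟩ := Homogeneous.exists_eigenvector hpos hfix hB hμ0
  have hne : Nonempty M.Edge := by
    by_contra hE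
    rw [not_nonempty_iff] at hE
    refine hl0 ?_
    rw [lambda1, perronEigenvalue, spectralRadius]
    simp [spectrum.of_subsingleton]
  obtain ⟨ρ, hρ, hρ1⟩ : ∃ ρ, M.lambda1 < ρ ∧ ρ * M.mu2 m < (M.lambda1 * M.mu2 m) ^ 2 := by
    have hev : ∀ᶠ ρ in 𝓝[>] M.lambda1, ρ * M.mu2 m < (M.lambda1 * M.mu2 m) ^ 2 :=
      (((continuous_id.mul continuous_const).tendsto M.lambda1).mono_left
        nhdsWithin_le_nhds).eventually_lt_const (show M.lambda1 * M.mu2 m < _ by nlinarith)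
    exact (eventually_mem_nhdsWithin.and hev).exists
  obtain ⟨C₁, hC₁⟩ := exists_norm_jacobian_pow_le hpos hfix hq hρ
  obtain ⟨c, hc, hcw⟩ := exists_norm_pow_mulVec_ge M.lineAdj
  obtain ⟨K, hK, hanti⟩ :=
    (M.mode m v).exists_antilipschitzWith (LinearMap.ker_eq_bot.2 (mode_injective hpos hvc))
  have hlow : ∀ w, ‖w‖ ≤ K * ‖M.mode m v w‖ := fun w => by
    simpa using hanti.le_mul_dist w 0
  set Z := LinearMap.toContinuousLinearMap (M.mode m v) with hZ
  have hup : ∀ w, ‖M.mode m v w‖ ≤ (‖Z‖ + 1) * ‖w‖ := fun w =>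
    (Z.le_opNorm w).trans (by gcongr; linarith)
  have hZ0 : 0 < ‖Z‖ + 1 := by positivity
  have hK0 : (0 : ℝ) < K := hK
  have hpow : ∀ n w, ‖(M.jacobian m ^ n) ((‖Z‖ + 1)⁻¹ • M.mode m v w)‖ =
      (‖Z‖ + 1)⁻¹ * (M.mu2 m ^ n * ‖M.mode m v (M.lineAdj ^ n *ᵥ w)‖) := fun n w => by
    have h1 : (M.jacobian m ^ n) (M.mode m v w) =
        ν ^ n • M.mode m v (M.lineAdj ^ n *ᵥ w) := by
      rw [← map_smul]
      show (M.jacobian m ^ n) (M.ofLog m _) = M.ofLog m _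
      rw [jacobian_pow_ofLog hpos hfix, transfer_pow_tensor hB hv]
    rw [map_smul, h1, norm_smul, norm_smul, norm_pow, Real.norm_eq_abs ν, hν, norm_inv,
      Real.norm_of_nonneg hZ0.le]
  refine not_lyapunovStable_of_growth (analyticAt_bpStep hpos) (hasFDerivAt_bpStep hpos hfix)
    h (mul_nonneg (hl.trans hρ.le) hμ) hρ1 (c := (‖Z‖ + 1)⁻¹ * ((K : ℝ)⁻¹ * c)) (by positivity) hC₁
    fun n => ?_
  obtain ⟨w, hwk, hwn⟩ := hcw n
  refine ⟨(‖Z‖ + 1)⁻¹ • M.mode m v w, fun k => ?_, ?_⟩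
  · rw [hpow, inv_mul_le_iff₀ hZ0, mul_pow]
    calc M.mu2 m ^ k * ‖M.mode m v (M.lineAdj ^ k *ᵥ w)‖
        ≤ M.mu2 m ^ k * ((‖Z‖ + 1) * M.lambda1 ^ k) := by
          gcongr
          refine (hup _).trans ?_
          gcongr
          exact hwk k
      _ = _ := by ring
  · rw [hpow, mul_assoc]
    refine mul_le_mul_of_nonneg_left ?_ (inv_nonneg.2 hZ0.le)
    have h1 : c * M.lambda1 ^ n ≤ K * ‖M.mode m v (M.lineAdj ^ n *ᵥ w)‖ := hwn.trans (hlow _)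
    rw [mul_pow, mul_assoc, inv_mul_le_iff₀ hK0]
    calc c * (M.lambda1 ^ n * M.mu2 m ^ n) = M.mu2 m ^ n * (c * M.lambda1 ^ n) := by ring
      _ ≤ M.mu2 m ^ n * (K * ‖M.mode m v (M.lineAdj ^ n *ᵥ w)‖) := by gcongr
      _ = _ := by ring

end MarkovField

end

theorem theorem1 {V F : Type*} [Fintype V] [DecidableEq V] [Fintype F] [DecidableEq F] {q : ℕ}
    (M : MarkovField V F q) (m : M.Messages) (hpos : ∀ e k, 0 < m e k)
    (hfix : M.bpStep m = m) :
    (M.lambda1 * M.mu2 m < 1 → LyapunovStable M.bpStep m ∧ LocallyAttractive M.bpStep m) ∧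
    (M.Homogeneous m → LyapunovStable M.bpStep m → M.lambda1 * M.mu2 m ≤ 1) :=
  ⟨MarkovField.stable_of_lambda1_mul_mu2_lt_one hpos hfix, fun hhom hst =>
    not_lt.1 fun h => MarkovField.not_lyapunovStable_of_one_lt hpos hfix hhom h hst⟩
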